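/- **Setting.** Let $G=(V,E)$ be a finite undirected graph (parallel edges allowed) with edge costs $c_e\ge 0$ and source-sink pairs $(s_1,t_1),\dots,(s_r,t_r)$, $s_i\neq t_i$. In 2-route multicut one seeks a cheap set $Z\subseteq E$ such that for every $i$ the graph $(V,E\setminus Z)$ does not contain two edge-disjoint $s_i$-$t_i$ paths; such a $Z$ is called feasible. Let $(x,\{y^i\}_{i=1}^r)$ be an optimal solution, of value $\mathrm{OPT}=\sum_e c_ex_e$, of the linear program $$\min \sum_e c_e x_e\quad\text{s.t.}\quad \sum_{e\in P}(x_e+y^i_e)\ge 1\ \ \text{for all } i \text{ and all simple } s_i\text{-}t_i \text{ paths } P;\quad \sum_e y^i_e\le 1\ \ \text{for all } i;\quad x,y\ge 0. \tag{P}$$ **Subdivision.** Replace every edge $e$ by a path of $r+1$ edges $e_0,\dots,e_r$, each of cost $c_e$; put $x_{e_0}=x_e$, $y^i_{e_i}=y^i_e$ and all other values $0$. From here on $G=(V,E)$, $x$, $y^i$ denote the subdivided graph and these values; the edges $e_0$ are called $x$-edges. A set $Z$ of edges of the subdivided graph corresponds to the set $\bar Z$ of all original edges $e$ with some $e_j\in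 Z$. **Notation.** Let $\ell^i$ be the shortest-path metric of $G$ for the lengths $x_e+y^i_e$ (with value $\infty$ between different components), and $\beta=\mathrm{OPT}/r$. For $S\subseteq V$ let $E(S)$ be the set of edges with both ends in $S$, $\delta^S(A)$ the set of edges between $A$ and $S\setminus A$ (for $A\subseteq S$), and $\mathcal V^x(S)=\beta+\sum_{e\in E(S)}c_ex_e$. Let $c^2(D)$ be the cost of all edges of $D$ except the most expensive one. For a commodity $i$ and $\rho\ge 0$ let $B=\{v\in S:\ell^i(s_i,v)\le\rho\}$, $\bar B=S\setminus B$, and $$\mathcal V=\beta+\sum_{uv}c_{uv}\ell^i(u,v)+\sum_{uv}c_{uv}(\rho-\ell^i(s_i,u)),\qquad \overline{\mathcal V}=\beta+\sum_{uv}c_{uv}\ell^i(u,v)+\sum_{uv}c_{uv}(\ell^i(s_i,v)-\rho),$$ where all sums are over $x$-edges $uv$: the first sum of $\mathcal V$ over those with $u,v\in B$, the first sum of $\overline{\mathcal V}$ over those with $u,v\in\bar B$, and the second sums over those with $u\in B$, $v\in\bar B$. Call $\rho$ *good* for $(S,i)$ if $0\le\rho<1$ and $$c^2(\delta^S(B))\le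 4\,W\,\ln\Bigl(\frac{e\,\mathcal V^x(S)}{W}\Bigr)\,\ln\ln(e(r+1))\qquad\text{for } W=\mathcal V \text{ and for } W=\overline{\mathcal V}$$ (the right side being read as $0$ if $W=0$). **Algorithm 2-MCAlg$(U,\mathcal T)$**, for $U\subseteq V$ and a set $\mathcal T$ of source-sink pairs contained in $U$. Start with $S=U$, $Z=\emptyset$, $\mathcal S=\emptyset$. While some pair of $\mathcal T$ has two edge-disjoint paths in $(S,E(S))$: pick such a pair $(s_i,t_i)$ and a $\rho$ that is good for $(S,i)$; let $A=B$ if $B$ contains at most $|\mathcal T|/2$ pairs of $\mathcal T$, and $A=\bar B$ otherwise; add $A$ to $\mathcal S$, add all edges of $\delta^S(A)$ except a most expensive one to $Z$, and replace $S$ by $S\setminus A$. Afterwards, for every $A\in\mathcal S$ add to $Z$ the output of 2-MCAlg$(A,\{(s_i,t_i)\in\mathcal T: s_i,t_i\in A\})$; return $Z$. The initial call is 2-MCAlg$(V,\{(s_1,t_1),\dots,(s_r,t_r)\})$. **Theorem.** There is an absolute constant $C>0$ such that for every instance and every optimal solution of (P), whatever choices are made, the initial call of 2-MCAlg never gets stuck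 (a good radius always exists) and terminates, and for its output $Z$: 1. $Z$ is feasible for the subdivided instance and $\bar Z$ is feasible for the original one: every pair $s_i,t_i$ is at most 1-edge-connected in the graph that remains after the removal of the set; 2. $c(\bar Z)\le c(Z)\le C\,\ln(r+1)\,\ln\ln(e(r+1))\cdot\mathrm{OPT}$, and $c(Z)\le C\,\ln r\,\ln\ln r\cdot\mathrm{OPT}$ if $r\ge 3$; that is, the cost is $O(\ln r\ln\ln r)\cdot\mathrm{OPT}$. -/

import Mathlib

open scoped ENNReal

/-- An undirected multigraph with node set `V` and edge set `E`. Parallel edges are allowed. The two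
ends of an edge are listed in an arbitrary order, which carries no meaning: see `Joins`. -/
structure Multigraph (V : Type*) (E : Type*) where
  fst : E → V
  snd : E → V

namespace Multigraph

universe u v

variable {V : Type u} {E : Type v} (G : Multigraph V E)

/-- `e` is an (undirected) edge between `a` and `b`. -/
def Joins (e : E) (a b : V) : Prop :=
  (G.fst e = a ∧ G.snd e = b) ∨ (G.fst e = b ∧ G.snd e = a)

inductive Walk : V → V → Type (max u v)
  | nil (a : V) : Walk a a
  | cons {a b d : V} (e : E) (h : G.Joins e a b) (p : Walk b d) : Walk a d

namespace Walk

variable {G}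

def edges : {a b : V} → G.Walk a b → List E
  | _, _, nil _ => []
  | _, _, cons e _ p => e :: p.edges

def support : {a b : V} → G.Walk a b → List V
  | _, _, nil a => [a]
  | a, _, cons _ _ p => a :: p.support

/-- A simple path: no node is repeated. -/
def IsPath {a b : V} (p : G.Walk a b) : Prop := p.support.Nodup

/-- The length of a walk with respect to the edge lengths `w`. -/
def length (w : E → ℝ) {a b : V} (p : G.Walk a b) : ℝ := (p.edges.map w).sum

end Walk

/-- `E(S)`: the edges with both ends in `S`. -/
def edgesIn (S : Set V) : Set E := {e | G.fst e ∈ S ∧ G.snd e ∈ S}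

/-- `δ^S(A)`: the edges with one end in `A` and the other one in `S \ A`. -/
def cut (S A : Set V) : Set E :=
  {e | (G.fst e ∈ A ∧ G.snd e ∈ S \ A) ∨ (G.snd e ∈ A ∧ G.fst e ∈ S \ A)}

/-- `a` and `b` are at least `k`-edge-connected by means of the edges in `D`: there are `k` pairwise
edge-disjoint simple `a`-`b` paths all of whose edges belong to `D`. -/
def EdgeConnected (D : Set E) (k : ℕ) (a b : V) : Prop :=
  ∃ P : Fin k → G.Walk a b,
    (∀ j, (P j).IsPath) ∧ (∀ j, ∀ e ∈ (P j).edges, e ∈ D) ∧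
      ∀ j j', j ≠ j' → List.Disjoint (P j).edges (P j').edges

/-- The shortest-path distance for the edge lengths `w`; it is `∞` if there is no walk. -/
noncomputable def edist (w : E → ℝ) (a b : V) : ℝ≥0∞ :=
  ⨅ p : G.Walk a b, ENNReal.ofReal (p.length w)

/-- The same distance as a real number; it is only used for nodes at finite distance. -/
noncomputable def dist (w : E → ℝ) (a b : V) : ℝ := (G.edist w a b).toReal

/-- `B_ℓ(z, ρ)` for the shortest-path metric `ℓ` of the edge lengths `w`. -/
def ball (w : E → ℝ) (z : V) (ρ : ℝ) : Set V := {b | G.edist w z b ≤ ENNReal.ofReal ρ}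

end Multigraph

/-- A multicut instance with `r` source-sink pairs (commodities) and nonnegative edge costs. -/
structure MulticutInstance (V : Type*) (E : Type*) (r : ℕ) extends Multigraph V E where
  cost : E → ℝ
  cost_nonneg : ∀ e, 0 ≤ cost e
  source : Fin r → V
  sink : Fin r → V
  source_ne_sink : ∀ i, source i ≠ sink i

namespace MulticutInstance

section Problem

variable {V E : Type*} [Fintype E] {r : ℕ} (I : MulticutInstance V E r)

/-- `c(Z)`, the cost of an edge set. -/
noncomputable def costOf (Z : Set E) : ℝ := ∑ e, Z.indicator I.cost e

/-- `c²(D)`: the cost of all edges of `D` but the most expensive one; it is `0` for `D = ∅`, since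
`sSup ∅ = 0`. -/
noncomputable def costButMax (D : Set E) : ℝ := I.costOf D - sSup (I.cost '' D)

/-- `Y` consists of all edges of `D` but one most expensive edge of `D` (ties are broken
arbitrarily). -/
def IsAllButMax (D Y : Set E) : Prop :=
  (D = ∅ ∧ Y = ∅) ∨ ∃ e ∈ D, (∀ f ∈ D, I.cost f ≤ I.cost e) ∧ Y = D \ {e}

/-- `Z` is a feasible solution of `k`-route multicut: after the removal of `Z` no source-sink pair
has `k` edge-disjoint paths. -/
def IsFeasible (k : ℕ) (Z : Set E) : Prop :=
  ∀ i, ¬ I.EdgeConnected Zᶜ k (I.source i) (I.sink i)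

/-- Feasibility for the LP relaxation
`min ∑ c_e x_e` s.t. `∑_{e ∈ P} (x_e + y^i_e) ≥ 1` for all `i` and all simple `s_i`-`t_i` paths `P`,
`∑_e y^i_e ≤ k - 1` for all `i`, and `x, y ≥ 0`. -/
structure IsLPFeasible (k : ℕ) (x : E → ℝ) (y : Fin r → E → ℝ) : Prop where
  path : ∀ i, ∀ P : I.Walk (I.source i) (I.sink i), P.IsPath → 1 ≤ P.length (fun e => x e + y i e)
  budget : ∀ i, ∑ e, y i e ≤ (k : ℝ) - 1
  x_nonneg : ∀ e, 0 ≤ x e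
  y_nonneg : ∀ i e, 0 ≤ y i e

noncomputable def lpValue (x : E → ℝ) : ℝ := ∑ e, I.cost e * x e

def IsLPOptimal (k : ℕ) (x : E → ℝ) (y : Fin r → E → ℝ) : Prop :=
  I.IsLPFeasible k x y ∧ ∀ x' y', I.IsLPFeasible k x' y' → I.lpValue x ≤ I.lpValue x'

end Problem

section Subdivision

variable {V E : Type*} {r : ℕ} (I : MulticutInstance V E r)

/-- The nodes `w_0, w_1, …, w_r, w_{r+1}` of the path that replaces the edge `e`: `w_0` and `w_{r+1}`
are the ends of `e`, the others are new. -/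
def subNode (e : E) (j : Fin (r + 2)) : V ⊕ E × Fin r :=
  Fin.cases (Sum.inl (I.fst e))
    (fun j' : Fin (r + 1) =>
      Fin.lastCases (motive := fun _ => V ⊕ E × Fin r) (Sum.inl (I.snd e))
        (fun m : Fin r => Sum.inr (e, m)) j') j

/-- The instance in which every edge `e` is subdivided into `r + 1` edges `e_0, …, e_r`, each of the
cost of `e`; here `e_j` is the pair `(e, j)`. -/
def subdivide : MulticutInstance (V ⊕ E × Fin r) (E × Fin (r + 1)) r where
  fst f := I.subNode f.1 f.2.castSucc
  snd f := I.subNode f.1 f.2.succ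
  cost f := I.cost f.1
  cost_nonneg f := I.cost_nonneg f.1
  source i := Sum.inl (I.source i)
  sink i := Sum.inl (I.sink i)
  source_ne_sink i h := I.source_ne_sink i (Sum.inl_injective h)

/-- The `x`-edges `e_0` of the subdivided graph. -/
def xEdges (E : Type*) (r : ℕ) : Set (E × Fin (r + 1)) := {f | f.2 = 0}

/-- The whole `x`-value of `e` is put on `e_0`. -/
def subX (r : ℕ) (x : E → ℝ) (f : E × Fin (r + 1)) : ℝ := if f.2 = 0 then x f.1 else 0

/-- The whole `y^i`-value of `e` is put on `e_i` (commodities are numbered from `0` in `Fin r`, so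
that this is the subdivision edge with index `i.succ`). -/
def subY (y : Fin r → E → ℝ) (i : Fin r) (f : E × Fin (r + 1)) : ℝ :=
  if f.2 = i.succ then y i f.1 else 0

/-- The edge set of the original graph given by an edge set of the subdivided graph: the edges that
have a part in it. -/
def unsubdivide (Z : Set (E × Fin (r + 1))) : Set E := Prod.fst '' Z

end Subdivision

section Rounding

/-! The recursive rounding procedure, on an instance `I` with edge set `E`, with a set `F` of edges
that count for the volume (the `x`-edges) and a fractional solution `(x, y)`. -/

variable {V E : Type*} [Fintype E] {r : ℕ} (I : MulticutInstance V E r)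
  (F : Set E) (x : E → ℝ) (y : Fin r → E → ℝ)

/-- `β = OPT / r`. -/
noncomputable def beta : ℝ := I.lpValue x / r

/-- `ℓ^i`, the shortest-path metric of the lengths `x + y^i`. -/
noncomputable def ell (i : Fin r) (a b : V) : ℝ := I.dist (fun e => x e + y i e) a b

/-- `B^S_i(z, ρ)`. -/
def ballIn (S : Set V) (i : Fin r) (z : V) (ρ : ℝ) : Set V :=
  I.ball (fun e => x e + y i e) z ρ ∩ S

/-- The complement of `B^S_i(z, ρ)` in `S`. -/
def ballOut (S : Set V) (i : Fin r) (z : V) (ρ : ℝ) : Set V :=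
  S \ I.ball (fun e => x e + y i e) z ρ

/-- The volume of the ball `B^S_i(z, ρ)`. The last two sums run over the boundary edges; they
differ in which end lies in the ball. -/
noncomputable def vol (S : Set V) (i : Fin r) (z : V) (ρ : ℝ) : ℝ :=
  I.beta x
    + ∑ e, (F ∩ I.edgesIn (I.ballIn x y S i z ρ)).indicator
        (fun e => I.cost e * I.ell x y i (I.fst e) (I.snd e)) e
    + ∑ e, {e ∈ F | I.fst e ∈ I.ballIn x y S i z ρ ∧ I.snd e ∈ I.ballOut x y S i z ρ}.indicator
        (fun e => I.cost e * (ρ - I.ell x y i z (I.fst e))) e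
    + ∑ e, {e ∈ F | I.snd e ∈ I.ballIn x y S i z ρ ∧ I.fst e ∈ I.ballOut x y S i z ρ}.indicator
        (fun e => I.cost e * (ρ - I.ell x y i z (I.snd e))) e

/-- The volume of the complement of `B^S_i(z, ρ)` in `S`. -/
noncomputable def volOut (S : Set V) (i : Fin r) (z : V) (ρ : ℝ) : ℝ :=
  I.beta x
    + ∑ e, (F ∩ I.edgesIn (I.ballOut x y S i z ρ)).indicator
        (fun e => I.cost e * I.ell x y i (I.fst e) (I.snd e)) e
    + ∑ e, {e ∈ F | I.fst e ∈ I.ballIn x y S i z ρ ∧ I.snd e ∈ I.ballOut x y S i z ρ}.indicator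
        (fun e => I.cost e * (I.ell x y i z (I.snd e) - ρ)) e
    + ∑ e, {e ∈ F | I.snd e ∈ I.ballIn x y S i z ρ ∧ I.fst e ∈ I.ballOut x y S i z ρ}.indicator
        (fun e => I.cost e * (I.ell x y i z (I.fst e) - ρ)) e

/-- `V^x(S) = β + ∑_{e ∈ E(S)} c_e x_e`. -/
noncomputable def volX (S : Set V) : ℝ :=
  I.beta x + ∑ e, (I.edgesIn S).indicator (fun e => I.cost e * x e) e

/-- The radii that the algorithm may use for the commodity `i` and the current set `S` (the
constant is `2 / (1 - α)` for `α = 1 / 2`). If `OPT = 0`, then all volumes are `0`, and the right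
sides are read as `0`. -/
def GoodRadius (S : Set V) (i : Fin r) (ρ : ℝ) : Prop :=
  0 ≤ ρ ∧ ρ < 1 ∧
    I.costButMax (I.cut S (I.ballIn x y S i (I.source i) ρ)) ≤
      4 * I.vol F x y S i (I.source i) ρ *
        Real.log (Real.exp 1 * I.volX x S / I.vol F x y S i (I.source i) ρ) *
        Real.log (Real.log (Real.exp 1 * (r + 1))) ∧
    I.costButMax (I.cut S (I.ballIn x y S i (I.source i) ρ)) ≤
      4 * I.volOut F x y S i (I.source i) ρ *
        Real.log (Real.exp 1 * I.volX x S / I.volOut F x y S i (I.source i) ρ) *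
        Real.log (Real.log (Real.exp 1 * (r + 1)))

/-- The pairs of `T` that are contained in `A`; pairs are represented by their indices. -/
def pairsIn (T : Set (Fin r)) (A : Set V) : Set (Fin r) :=
  {i ∈ T | I.source i ∈ A ∧ I.sink i ∈ A}

/-- `T'`: the pairs of `T` that are at least 2-edge-connected in `(S, E(S))`. -/
def active (T : Set (Fin r)) (S : Set V) : Set (Fin r) :=
  {i ∈ T | I.EdgeConnected (I.edgesIn S) 2 (I.source i) (I.sink i)}

/-- The region that is carved out: the ball if it contains at most half of the pairs of `T`, and
its complement in `S` otherwise. -/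
noncomputable def region (T : Set (Fin r)) (S : Set V) (i : Fin r) (ρ : ℝ) : Set V :=
  if 2 * (I.pairsIn T (I.ballIn x y S i (I.source i) ρ)).ncard ≤ T.ncard then
    I.ballIn x y S i (I.source i) ρ
  else I.ballOut x y S i (I.source i) ρ

/-- One iteration of the while loop, with current set `S`, may carve out the region `A` and add the
edge set `Y` to the solution. -/
def Step (T : Set (Fin r)) (S A : Set V) (Y : Set E) : Prop :=
  ∃ i ∈ I.active T S, ∃ ρ, I.GoodRadius F x y S i ρ ∧ A = I.region x y T S i ρ ∧
    I.IsAllButMax (I.cut S A) Y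

/-- The while loop, started with current set `S`, may end after carving out the family `R` of
regions and adding the edge set `Z` to the solution. -/
inductive Loop (T : Set (Fin r)) : Set V → Set (Set V) → Set E → Prop
  | done (S : Set V) (h : I.active T S = ∅) : Loop T S ∅ ∅
  | step (S A : Set V) (Y : Set E) (R : Set (Set V)) (Z : Set E)
      (h : I.Step F x y T S A Y) (hl : Loop T (S \ A) R Z) : Loop T S (insert A R) (Y ∪ Z)

/-- `Z` is a possible output of the procedure on the node set `U` and the set `T` of pairs: run the
while loop from `S = U`, then recurse on every region `A` and the pairs contained in it. -/
inductive Output : Set V → Set (Fin r) → Set E → Prop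
  | mk (U : Set V) (T : Set (Fin r)) (R : Set (Set V)) (Z : Set E) (sub : Set V → Set E)
      (hl : I.Loop F x y T U R Z) (hr : ∀ A ∈ R, Output A (I.pairsIn T A) (sub A)) :
      Output U T (Z ∪ ⋃ A ∈ R, sub A)

/-- Every execution of the while loop from `S` comes to an end and never gets stuck: whichever pair
is picked there is an admissible radius, whatever the choices are. -/
inductive LoopHalts (T : Set (Fin r)) : Set V → Prop
  | intro (S : Set V) (h : ∀ i ∈ I.active T S, ∃ ρ, I.GoodRadius F x y S i ρ)
      (hs : ∀ A Y, I.Step F x y T S A Y → LoopHalts T (S \ A)) : LoopHalts T S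

/-- Every execution of the procedure on `U` and `T` comes to an end and never gets stuck. -/
inductive Halts : Set V → Set (Fin r) → Prop
  | intro (U : Set V) (T : Set (Fin r)) (hl : I.LoopHalts F x y T U)
      (hr : ∀ R Z, I.Loop F x y T U R Z → ∀ A ∈ R, Halts A (I.pairsIn T A)) : Halts U T

end Rounding

section Algorithm

variable {V E : Type*} [Fintype E] {r : ℕ} (I : MulticutInstance V E r)
  (x : E → ℝ) (y : Fin r → E → ℝ)

/-- `Z` is a possible output of 2-MCAlg with the LP solution `(x, y)`: an edge set of the subdivided
graph, returned by the initial call with all nodes and all pairs. -/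
def TwoMCAlgOutput (Z : Set (E × Fin (r + 1))) : Prop :=
  I.subdivide.Output (xEdges E r) (subX r x) (subY y) Set.univ Set.univ Z

/-- 2-MCAlg with the LP solution `(x, y)` always terminates and never gets stuck. -/
def TwoMCAlgHalts : Prop :=
  I.subdivide.Halts (xEdges E r) (subX r x) (subY y) Set.univ Set.univ

end Algorithm

end MulticutInstance

/-!
Fix a commodity `i` and let the radius `ρ` of the ball around `s_i` run from `0` to `1`. The volume
`W` of the ball grows at the rate `p(ρ) = c(δ(B) ∩ F)`, where `F` is the set of `x`-edges, and the
volume of the complement shrinks at that rate. The function `log log (e K / W)`, where `K` is the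
volume of `S`, changes at the rate `p / (W log (e K / W))` in absolute value and by at most
`log log (e (r + 1))` in total. Since the `y`-edges have total length at most `1`, the average
number of `y`-edges in the cut is at most `1`, which still leaves a radius where at most one
`y`-edge is cut and both rates are small. The `y`-edge is then the edge that need not be paid for.

For the cost, write `L = log log (e (r + 1))`. Carving out a region whose removal deletes edges of
weight `w` costs `O(L) W log (e K / W)` with `W = β + w`. Since `log (K / W) + log (W / β)` is
`log (K / β)`, the logarithm telescopes along the recursion: every edge pays one unit for each level
of recursion, of which there are at most `log₂ r + 1` because the number of pairs halves, and
`log (r + 1)` in addition. The terms `β log (e (r + 1))` are charged to a pair that is separated by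
the region; this happens at most once to each of the `r` pairs, and `r β = OPT`.
-/

namespace Multigraph

variable {V E : Type*} {G : Multigraph V E}

section Cuts

theorem joins_fst_snd (G : Multigraph V E) (e : E) : G.Joins e (G.fst e) (G.snd e) :=
  Or.inl ⟨rfl, rfl⟩

variable {e : E} {a b : V} {S A : Set V}

theorem Joins.symm (h : G.Joins e a b) : G.Joins e b a := Or.symm h

theorem Joins.mem_edgesIn_iff (h : G.Joins e a b) : e ∈ G.edgesIn S ↔ a ∈ S ∧ b ∈ S := by
  rcases h with ⟨rfl, rfl⟩ | ⟨rfl, rfl⟩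
  exacts [Iff.rfl, And.comm]

theorem Joins.mem_cut_iff (h : G.Joins e a b) (hS : e ∈ G.edgesIn S) :
    e ∈ G.cut S A ↔ ¬ (a ∈ A ↔ b ∈ A) := by
  have := h.mem_edgesIn_iff.1 hS
  simp only [cut, Set.mem_ofPred_eq, Set.mem_sdiff]
  rcases h with ⟨rfl, rfl⟩ | ⟨rfl, rfl⟩ <;> tauto

theorem edgesIn_mono (G : Multigraph V E) (h : A ⊆ S) : G.edgesIn A ⊆ G.edgesIn S :=
  fun _ he => ⟨h he.1, h he.2⟩

theorem cut_sdiff (G : Multigraph V E) (h : A ⊆ S) : G.cut S (S \ A) = G.cut S A := by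
  simp only [cut, Set.sdiff_sdiff_cancel_left h, Set.mem_sdiff, and_comm, or_comm]

end Cuts

namespace Walk

@[simp]
theorem edges_nil (a : V) : (nil a : G.Walk a a).edges = [] := rfl

@[simp]
theorem edges_cons {a b d : V} (e : E) (h : G.Joins e a b) (p : G.Walk b d) :
    (cons e h p).edges = e :: p.edges := rfl

/-- Concatenation of walks. -/
def append : {a b d : V} → G.Walk a b → G.Walk b d → G.Walk a d
  | _, _, _, nil _, q => q
  | _, _, _, cons e h p, q => cons e h (p.append q)

@[simp]
theorem edges_append {a b d : V} (p : G.Walk a b) (q : G.Walk b d) :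
    (p.append q).edges = p.edges ++ q.edges := by
  induction p with
  | nil => rfl
  | cons e h p ih => simp [append, ih]

/-- The same walk, traversed backwards. -/
def reverse : {a b : V} → G.Walk a b → G.Walk b a
  | _, _, nil a => nil a
  | _, _, cons e h p => p.reverse.append (cons e h.symm (nil _))

@[simp]
theorem edges_reverse {a b : V} (p : G.Walk a b) : p.reverse.edges = p.edges.reverse := by
  induction p with
  | nil => rfl
  | cons e h p ih => simp [reverse, ih]

section Length

variable (w : E → ℝ) {a b d : V}

@[simp]
theorem length_nil : (nil a : G.Walk a a).length w = 0 := rfl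

@[simp]
theorem length_cons {e : E} (h : G.Joins e a b) (p : G.Walk b d) :
    (cons e h p).length w = w e + p.length w := by
  simp [length]

theorem length_append (p : G.Walk a b) (q : G.Walk b d) :
    (p.append q).length w = p.length w + q.length w := by
  simp [length]

theorem length_reverse (p : G.Walk a b) : p.reverse.length w = p.length w := by
  simp [length, List.sum_reverse]

variable {w} (hw : ∀ e, 0 ≤ w e)
include hw

theorem length_nonneg (p : G.Walk a b) : 0 ≤ p.length w :=
  List.sum_nonneg (List.forall_mem_map.2 fun e _ => hw e)

theorem length_le_of_sublist {a' b' : V} {p : G.Walk a b} {q : G.Walk a' b'}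
    (h : q.edges.Sublist p.edges) : q.length w ≤ p.length w :=
  (h.map w).sum_le_sum (List.forall_mem_map.2 fun e _ => hw e)

end Length

theorem start_mem_support {a b : V} (p : G.Walk a b) : a ∈ p.support := by
  cases p <;> simp [support]

theorem exists_isPath_of_mem_support {a d u : V} (p : G.Walk a d) (hp : p.IsPath)
    (hu : u ∈ p.support) : ∃ q : G.Walk u d, q.IsPath ∧ q.edges.Sublist p.edges := by
  induction p with
  | nil a =>
    obtain rfl : u = a := by simpa [support] using hu
    exact ⟨nil u, hp, .refl _⟩
  | cons e h p ih =>
    rcases List.mem_cons.1 hu with rfl | hu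
    · exact ⟨cons e h p, hp, .refl _⟩
    · obtain ⟨q, hq, hs⟩ := ih (List.nodup_cons.1 hp).2 hu
      exact ⟨q, hq, hs.cons _⟩

theorem exists_isPath {a b : V} (p : G.Walk a b) :
    ∃ q : G.Walk a b, q.IsPath ∧ q.edges.Sublist p.edges := by
  induction p with
  | nil a => exact ⟨nil a, by simp [IsPath, support], .refl _⟩
  | @cons a b d e h p ih =>
    obtain ⟨q, hq, hs⟩ := ih
    by_cases ha : a ∈ q.support
    · obtain ⟨q', hq', hs'⟩ := q.exists_isPath_of_mem_support hq ha
      exact ⟨q', hq', (hs'.trans hs).cons _⟩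
    · exact ⟨cons e h q, List.nodup_cons.2 ⟨ha, hq⟩, hs.cons_cons _⟩

theorem mem_support_of_joins {a b u v : V} (p : G.Walk a b) {e : E} (he : e ∈ p.edges)
    (h : G.Joins e u v) : u ∈ p.support := by
  induction p with
  | nil a => simp at he
  | @cons a b d f hf p ih =>
    rcases List.mem_cons.1 he with rfl | he
    · have : u = a ∨ u = b := by
        rcases h with ⟨rfl, rfl⟩ | ⟨rfl, rfl⟩ <;> rcases hf with ⟨h1, h2⟩ | ⟨h1, h2⟩ <;> simp [*]
      rcases this with rfl | rfl
      · exact List.mem_cons_self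
      · exact List.mem_cons_of_mem _ p.start_mem_support
    · exact List.mem_cons_of_mem _ (ih he)

theorem IsPath.edges_nodup {a b : V} {p : G.Walk a b} (hp : p.IsPath) : p.edges.Nodup := by
  induction p with
  | nil a => exact List.nodup_nil
  | cons f hf p ih =>
    obtain ⟨hf_mem, hp⟩ := List.nodup_cons.1 hp
    exact List.nodup_cons.2 ⟨fun h => hf_mem (p.mem_support_of_joins h hf), ih hp⟩

section InSet

variable {S A : Set V} {a b : V}

theorem ends_mem (p : G.Walk a b) (hab : a ≠ b) (hp : ∀ e ∈ p.edges, e ∈ G.edgesIn S) :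
    a ∈ S ∧ b ∈ S := by
  induction p with
  | nil a => exact absurd rfl hab
  | @cons a b d f hf p ih =>
    obtain ⟨hfS, hpS⟩ := List.forall_mem_cons.1 hp
    obtain ⟨ha, hb⟩ := hf.mem_edgesIn_iff.1 hfS
    refine ⟨ha, ?_⟩
    by_cases hbd : b = d
    · exact hbd ▸ hb
    · exact (ih hbd hpS).2

theorem exists_mem_cut (p : G.Walk a b) (hp : ∀ e ∈ p.edges, e ∈ G.edgesIn S)
    (hab : ¬ (a ∈ A ↔ b ∈ A)) : ∃ e ∈ p.edges, e ∈ G.cut S A := by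
  induction p with
  | nil a => exact absurd Iff.rfl hab
  | @cons a b d f hf p ih =>
    obtain ⟨hfS, hpS⟩ := List.forall_mem_cons.1 hp
    by_cases hd : b ∈ A ↔ d ∈ A
    · exact ⟨f, List.mem_cons_self, (hf.mem_cut_iff hfS).2 (by rwa [hd])⟩
    · obtain ⟨e, he, hc⟩ := ih hpS hd
      exact ⟨e, List.mem_cons_of_mem _ he, hc⟩

theorem mem_edgesIn_of_cut_subsingleton (p : G.Walk a b) (hp : ∀ e ∈ p.edges, e ∈ G.edgesIn S)
    (hn : p.edges.Nodup) (hc : ({e | e ∈ p.edges} ∩ G.cut S A).Subsingleton) (ha : a ∈ A)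
    (hb : b ∈ A) : ∀ e ∈ p.edges, e ∈ G.edgesIn A := by
  induction p with
  | nil a => simp
  | @cons a u d f hf p ih =>
    obtain ⟨hfS, hpS⟩ := List.forall_mem_cons.1 hp
    obtain ⟨hfp, hn⟩ := List.nodup_cons.1 hn
    have hu : u ∈ A := by
      by_contra hu
      obtain ⟨e, he, hce⟩ := p.exists_mem_cut hpS (A := A) (by tauto)
      obtain rfl : f = e := hc ⟨List.mem_cons_self, (hf.mem_cut_iff hfS).2 (by tauto)⟩
        ⟨List.mem_cons_of_mem _ he, hce⟩
      exact hfp he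
    exact List.forall_mem_cons.2 ⟨hf.mem_edgesIn_iff.2 ⟨ha, hu⟩,
      ih hpS hn (hc.anti (Set.inter_subset_inter_left _ fun _ => List.mem_cons_of_mem _)) hu hb⟩

end InSet

end Walk

namespace EdgeConnected

variable {D D' : Set E} {S A : Set V} {k : ℕ} {a b : V}

theorem mono (h : G.EdgeConnected D k a b) (hD : D ⊆ D') : G.EdgeConnected D' k a b := by
  obtain ⟨P, hpath, hPD, hdisj⟩ := h
  exact ⟨P, hpath, fun j e he => hD (hPD j e he), hdisj⟩

/-- The walks need not be simple, since they can be shortcut. -/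
theorem of_walks (P : Fin k → G.Walk a b) (hD : ∀ j, ∀ e ∈ (P j).edges, e ∈ D)
    (hd : ∀ j j', j ≠ j' → List.Disjoint (P j).edges (P j').edges) : G.EdgeConnected D k a b := by
  choose Q hQ hs using fun j => (P j).exists_isPath
  exact ⟨Q, hQ, fun j e he => hD j e ((hs j).subset he), fun j j' hj e he he' =>
    hd j j' hj ((hs j).subset he) ((hs j').subset he')⟩

theorem ends_mem (hk : k ≠ 0) (h : G.EdgeConnected (G.edgesIn S) k a b) (hab : a ≠ b) :
    a ∈ S ∧ b ∈ S := by
  obtain ⟨P, -, hPS, -⟩ := h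
  exact (P ⟨0, Nat.pos_of_ne_zero hk⟩).ends_mem hab (hPS _)

variable (hDS : D ⊆ G.edgesIn S) (hcut : (D ∩ G.cut S A).Subsingleton)
include hDS hcut

theorem inter_edgesIn (h : G.EdgeConnected D k a b) (ha : a ∈ A) (hb : b ∈ A) :
    G.EdgeConnected (D ∩ G.edgesIn A) k a b := by
  obtain ⟨P, hpath, hPD, hdisj⟩ := h
  refine ⟨P, hpath, fun j e he => ⟨hPD j e he, ?_⟩, hdisj⟩
  exact (P j).mem_edgesIn_of_cut_subsingleton (fun e he => hDS (hPD j e he))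
    (hpath j).edges_nodup (hcut.anti (Set.inter_subset_inter_left _ (hPD j))) ha hb e he

theorem mem_iff_mem (h : G.EdgeConnected D 2 a b) : a ∈ A ↔ b ∈ A := by
  obtain ⟨P, -, hPD, hdisj⟩ := h
  by_contra hab
  obtain ⟨e, he, hec⟩ := (P 0).exists_mem_cut (fun e he => hDS (hPD 0 e he)) hab
  obtain ⟨f, hf, hfc⟩ := (P 1).exists_mem_cut (fun e he => hDS (hPD 1 e he)) hab
  exact hdisj 0 1 (by decide) he (hcut ⟨hPD 0 e he, hec⟩ ⟨hPD 1 f hf, hfc⟩ ▸ hf)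

theorem side_of_cut_subsingleton (hAS : A ⊆ S) (hab : a ≠ b) (h : G.EdgeConnected D 2 a b) :
    (a ∈ A ∧ b ∈ A ∧ G.EdgeConnected (D ∩ G.edgesIn A) 2 a b) ∨
      G.EdgeConnected (D ∩ G.edgesIn (S \ A)) 2 a b := by
  have hiff := h.mem_iff_mem hDS hcut
  by_cases ha : a ∈ A
  · exact Or.inl ⟨ha, hiff.1 ha, h.inter_edgesIn hDS hcut ha (hiff.1 ha)⟩
  · obtain ⟨haS, hbS⟩ := (h.mono hDS).ends_mem two_ne_zero hab
    exact Or.inr (h.inter_edgesIn hDS (G.cut_sdiff hAS ▸ hcut) ⟨haS, ha⟩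
      ⟨hbS, fun hb => ha (hiff.2 hb)⟩)

end EdgeConnected

section Distance

variable {w : E → ℝ}

theorem edist_le {a b : V} (p : G.Walk a b) : G.edist w a b ≤ ENNReal.ofReal (p.length w) :=
  iInf_le _ p

theorem edist_self (G : Multigraph V E) (w : E → ℝ) (a : V) : G.edist w a a = 0 :=
  le_antisymm ((edist_le (.nil a)).trans (by simp)) zero_le

theorem edist_comm (G : Multigraph V E) (w : E → ℝ) (a b : V) :
    G.edist w a b = G.edist w b a := by
  have key : ∀ a b, G.edist w a b ≤ G.edist w b a := fun a b =>
    le_iInf fun p => (edist_le p.reverse).trans (by rw [Walk.length_reverse])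
  exact le_antisymm (key a b) (key b a)

theorem edist_le_of_joins {e : E} {a b : V} (h : G.Joins e a b) :
    G.edist w a b ≤ ENNReal.ofReal (w e) :=
  (edist_le (.cons e h (.nil b))).trans (by simp)

theorem edist_triangle (hw : ∀ e, 0 ≤ w e) (a b d : V) :
    G.edist w a d ≤ G.edist w a b + G.edist w b d := by
  refine ENNReal.le_iInf_add_iInf fun p q => (edist_le (p.append q)).trans ?_
  rw [Walk.length_append, ENNReal.ofReal_add (p.length_nonneg hw) (q.length_nonneg hw)]

/-- The distance from `z`, truncated at `1`. For radii in `[0, 1)` it defines the same balls, and it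
is finite everywhere. -/
noncomputable def truncDist (G : Multigraph V E) (w : E → ℝ) (z a : V) : ℝ :=
  (min (G.edist w z a) 1).toReal

theorem truncDist_nonneg (z a : V) : 0 ≤ G.truncDist w z a := ENNReal.toReal_nonneg

theorem truncDist_le_one (z a : V) : G.truncDist w z a ≤ 1 :=
  ENNReal.toReal_le_of_le_ofReal zero_le_one (by simp)

theorem truncDist_self (z : V) : G.truncDist w z z = 0 := by simp [truncDist, edist_self]

theorem truncDist_eq_one {a b : V} (h : ∀ p : G.Walk a b, 1 ≤ p.length w) :
    G.truncDist w a b = 1 := by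
  have : 1 ≤ G.edist w a b := le_iInf fun p => by simpa using ENNReal.ofReal_le_ofReal (h p)
  simp [truncDist, min_eq_right this]

theorem edist_lt_one {z a : V} (h : G.truncDist w z a < 1) : G.edist w z a < 1 := by
  by_contra! hle
  simp [truncDist, min_eq_right hle] at h

theorem truncDist_eq_dist {z a : V} (h : G.truncDist w z a < 1) :
    G.truncDist w z a = G.dist w z a := by
  rw [truncDist, min_eq_left (edist_lt_one h).le, dist]

theorem mem_ball_iff {z a : V} {ρ : ℝ} (h0 : 0 ≤ ρ) (h1 : ρ < 1) :
    a ∈ G.ball w z ρ ↔ G.truncDist w z a ≤ ρ := by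
  have hm : min (G.edist w z a) 1 ≠ ⊤ := ((min_le_right _ _).trans_lt ENNReal.one_lt_top).ne
  have h1' : ENNReal.ofReal ρ < 1 := by rwa [ENNReal.ofReal_lt_one]
  rw [truncDist, ← ENNReal.le_ofReal_iff_toReal_le hm h0, min_le_iff, or_iff_left h1'.not_ge]
  rfl

theorem Walk.sub_le_length {f : V → ℝ} (hf : ∀ e, |f (G.fst e) - f (G.snd e)| ≤ w e) {a b : V}
    (p : G.Walk a b) : f b - f a ≤ p.length w := by
  induction p with
  | nil a => simp
  | cons e h p ih =>
    have := abs_le.1 (hf e)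
    rw [length_cons]
    rcases h with ⟨rfl, rfl⟩ | ⟨rfl, rfl⟩ <;> linarith

section Joins

variable (hw : ∀ e, 0 ≤ w e) {e : E} {a b z : V} (h : G.Joins e a b)
include hw h

theorem Joins.dist_le : G.dist w a b ≤ w e :=
  ENNReal.toReal_le_of_le_ofReal (hw e) (edist_le_of_joins h)

theorem Joins.truncDist_le_add : G.truncDist w z b ≤ G.truncDist w z a + G.dist w a b := by
  have hab : G.edist w a b ≠ ⊤ := ((edist_le_of_joins h).trans_lt ENNReal.ofReal_lt_top).ne
  have hm : min (G.edist w z a) 1 ≠ ⊤ := ((min_le_right _ _).trans_lt ENNReal.one_lt_top).ne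
  rw [truncDist, truncDist, dist, ← ENNReal.toReal_add hm hab, min_add]
  exact ENNReal.toReal_mono (by simp [hab])
    (min_le_min (edist_triangle hw z a b) le_self_add)

theorem Joins.dist_mem_Icc (ha : G.truncDist w z a < 1) :
    G.dist w z b ∈ Set.Icc (G.truncDist w z b) (G.truncDist w z a + w e) := by
  have hza := ((edist_lt_one ha).trans ENNReal.one_lt_top).ne
  have hsum : G.edist w z a + ENNReal.ofReal (w e) ≠ ⊤ := by simp [hza]
  have hzb := (edist_triangle hw z a b).trans (add_le_add_right (edist_le_of_joins h) _)
  refine ⟨ENNReal.toReal_mono (ne_top_of_le_ne_top hsum hzb) (min_le_left _ _), ?_⟩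
  rw [truncDist_eq_dist ha, dist, dist, ← ENNReal.toReal_ofReal (hw e),
    ← ENNReal.toReal_add hza ENNReal.ofReal_ne_top]
  exact ENNReal.toReal_mono hsum hzb

end Joins

/-- The smaller truncated distance from `z` to an end of `e`. -/
noncomputable def nearDist (G : Multigraph V E) (w : E → ℝ) (z : V) (e : E) : ℝ :=
  min (G.truncDist w z (G.fst e)) (G.truncDist w z (G.snd e))

/-- The larger truncated distance from `z` to an end of `e`. -/
noncomputable def farDist (G : Multigraph V E) (w : E → ℝ) (z : V) (e : E) : ℝ :=
  max (G.truncDist w z (G.fst e)) (G.truncDist w z (G.snd e))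

section NearFar

variable (G w) (z : V) (e : E)

theorem nearDist_nonneg : 0 ≤ G.nearDist w z e :=
  le_min (truncDist_nonneg _ _) (truncDist_nonneg _ _)

theorem nearDist_le_farDist : G.nearDist w z e ≤ G.farDist w z e := min_le_max

theorem farDist_le_one : G.farDist w z e ≤ 1 := max_le (truncDist_le_one _ _) (truncDist_le_one _ _)

theorem farDist_sub_nearDist : G.farDist w z e - G.nearDist w z e =
    |G.truncDist w z (G.fst e) - G.truncDist w z (G.snd e)| := by
  rw [farDist, nearDist, max_sub_min_eq_abs, abs_sub_comm]

variable {w} (hw : ∀ e, 0 ≤ w e)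
include hw

theorem farDist_sub_nearDist_le_dist :
    G.farDist w z e - G.nearDist w z e ≤ G.dist w (G.fst e) (G.snd e) := by
  have hfs := (G.joins_fst_snd e).truncDist_le_add hw (z := z)
  have hsf := (G.joins_fst_snd e).symm.truncDist_le_add hw (z := z)
  rw [dist, edist_comm, ← dist] at hsf
  rw [farDist_sub_nearDist, abs_sub_le_iff]
  constructor <;> linarith

theorem abs_truncDist_sub_le : |G.truncDist w z (G.fst e) - G.truncDist w z (G.snd e)| ≤ w e := by
  rw [← farDist_sub_nearDist]
  exact (farDist_sub_nearDist_le_dist G z e hw).trans ((G.joins_fst_snd e).dist_le hw)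

end NearFar

end Distance

end Multigraph

namespace MulticutInstance

open Multigraph

/-- The edge lengths `x + y^i` of the commodity `i`; their metric is `ell`. -/
abbrev lengths {E : Type*} {r : ℕ} (x : E → ℝ) (y : Fin r → E → ℝ) (i : Fin r) : E → ℝ :=
  fun e => x e + y i e

/-- The properties of a fractional solution on which the rounding procedure relies: `x` lives on
`F`, the `y^i` live off `F` and have total value at most `1`, and the sinks are at distance at
least `1` from their sources. -/
structure IsRoundable {V E : Type*} [Fintype E] {r : ℕ} (I : MulticutInstance V E r) (F : Set E)
    (x : E → ℝ) (y : Fin r → E → ℝ) : Prop where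
  x_nonneg : ∀ e, 0 ≤ x e
  y_nonneg : ∀ i e, 0 ≤ y i e
  x_eq_zero : ∀ e, e ∉ F → x e = 0
  y_eq_zero : ∀ i e, e ∈ F → y i e = 0
  budget : ∀ i, ∑ e, y i e ≤ 1
  walk : ∀ i, ∀ P : I.Walk (I.source i) (I.sink i), 1 ≤ P.length (lengths x y i)

section Subdivision

variable {V E : Type*} {r : ℕ} (I : MulticutInstance V E r)

theorem subNode_zero (e : E) : I.subNode e 0 = Sum.inl (I.fst e) := rfl

theorem subNode_last (e : E) : I.subNode e (Fin.last (r + 1)) = Sum.inl (I.snd e) := by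
  rw [← Fin.succ_last]
  simp only [subNode, Fin.cases_succ, Fin.lastCases_last]

theorem subNode_castSucc_succ (e : E) (m : Fin r) :
    I.subNode e m.castSucc.succ = Sum.inr (e, m) := by
  simp [subNode]

section Potential

variable (x : E → ℝ) (y : Fin r → E → ℝ) (i : Fin r)

/-- The total length of the first `k` edges of the subdivision of `e`; the edge with index `i + 1`,
which carries `y^i`, is the one with number `i + 2`. -/
def subPrefix (e : E) (k : ℕ) : ℝ :=
  (if 1 ≤ k then x e else 0) + if (i : ℕ) + 2 ≤ k then y i e else 0

theorem subPrefix_zero (e : E) : subPrefix x y i e 0 = 0 := by simp [subPrefix]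

theorem subPrefix_last (e : E) : subPrefix x y i e (r + 1) = x e + y i e := by
  have : (i : ℕ) + 2 ≤ r + 1 := by lia
  simp [subPrefix, this]

theorem subPrefix_succ (e : E) (j : Fin (r + 1)) :
    subPrefix x y i e (j + 1) = subPrefix x y i e j + (subX r x (e, j) + subY y i (e, j)) := by
  have h0 : j = 0 ↔ (j : ℕ) = 0 := Fin.ext_iff
  have h1 : j = i.succ ↔ (j : ℕ) = i + 1 := by simp [Fin.ext_iff]
  simp only [subPrefix, subX, subY, h0, h1]
  split_ifs <;> first | lia | simp

/-- The extension of a function `d` on the nodes to the nodes of the subdivision that makes it a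
distance function: a new node is reached through one of the two ends of its edge. -/
noncomputable def subPotential (d : V → ℝ) : V ⊕ E × Fin r → ℝ
  | Sum.inl v => d v
  | Sum.inr (e, m) => min (d (I.fst e) + subPrefix x y i e (m + 1))
      (d (I.snd e) + (x e + y i e - subPrefix x y i e (m + 1)))

variable {x y i} {d : V → ℝ} (hd : ∀ e, |d (I.fst e) - d (I.snd e)| ≤ x e + y i e)
include hd

theorem subPotential_subNode (e : E) (j : Fin (r + 2)) :
    I.subPotential x y i d (I.subNode e j) = min (d (I.fst e) + subPrefix x y i e j)
      (d (I.snd e) + (x e + y i e - subPrefix x y i e j)) := by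
  have hde := abs_le.1 (hd e)
  induction j using Fin.cases with
  | zero =>
    rw [subNode_zero, subPotential, Fin.val_zero, subPrefix_zero, min_eq_left] <;> linarith
  | succ j =>
    induction j using Fin.lastCases with
    | last =>
      rw [Fin.succ_last, subNode_last, subPotential, Fin.val_last, subPrefix_last, min_eq_right]
        <;> linarith
    | cast m => rw [subNode_castSucc_succ, subPotential, Fin.val_succ, Fin.val_castSucc]

theorem abs_subPotential_sub_le (hx : ∀ e, 0 ≤ x e) (hy : ∀ e, 0 ≤ y i e)
    (f : E × Fin (r + 1)) :
    |I.subPotential x y i d (I.subdivide.fst f) - I.subPotential x y i d (I.subdivide.snd f)|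
      ≤ subX r x f + subY y i f := by
  obtain ⟨e, j⟩ := f
  have hn : 0 ≤ subX r x (e, j) + subY y i (e, j) := by
    simp only [subX, subY]
    exact add_nonneg (ite_nonneg (hx e) le_rfl) (ite_nonneg (hy e) le_rfl)
  change |I.subPotential x y i d (I.subNode e j.castSucc)
    - I.subPotential x y i d (I.subNode e j.succ)| ≤ _
  rw [subPotential_subNode I hd, subPotential_subNode I hd, Fin.val_castSucc, Fin.val_succ,
    subPrefix_succ]
  refine (abs_min_sub_min_le_max _ _ _ _).trans (max_le ?_ ?_) <;>
    rw [abs_le] <;> constructor <;> linarith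

end Potential

variable {I} in
theorem IsLPFeasible.isRoundable [Fintype E] {x : E → ℝ} {y : Fin r → E → ℝ}
    (h : I.IsLPFeasible 2 x y) :
    I.subdivide.IsRoundable (xEdges E r) (subX r x) (subY y) where
  x_nonneg f := ite_nonneg (h.x_nonneg f.1) le_rfl
  y_nonneg i f := ite_nonneg (h.y_nonneg i f.1) le_rfl
  x_eq_zero f hf := if_neg hf
  y_eq_zero i f (hf : f.2 = 0) := if_neg (hf ▸ (Fin.succ_ne_zero i).symm)
  budget i := by
    calc ∑ f, subY y i f = ∑ e, y i e := by simp [Fintype.sum_prod_type, subY]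
      _ ≤ 1 := (h.budget i).trans_eq (by norm_num)
  walk i P := by
    have hw : ∀ e, 0 ≤ x e + y i e := fun e => add_nonneg (h.x_nonneg e) (h.y_nonneg i e)
    have hsink : I.truncDist (lengths x y i) (I.source i) (I.sink i) = 1 := by
      refine truncDist_eq_one fun p => ?_
      obtain ⟨q, hq, hqp⟩ := p.exists_isPath
      exact (h.path i q hq).trans (Walk.length_le_of_sublist hw hqp)
    have hP := P.sub_le_length (I.abs_subPotential_sub_le
      (abs_truncDist_sub_le I.toMultigraph (I.source i) · hw) h.x_nonneg (h.y_nonneg i))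
    simpa only [subdivide, subPotential, hsink, truncDist_self, sub_zero] using hP

theorem lpValue_subdivide [Fintype E] (x : E → ℝ) :
    I.subdivide.lpValue (subX r x) = I.lpValue x := by
  simp [lpValue, Fintype.sum_prod_type, subX, subdivide]

theorem costOf_unsubdivide_le [Fintype E] (Z : Set (E × Fin (r + 1))) :
    I.costOf (unsubdivide Z) ≤ I.subdivide.costOf Z := by
  rw [costOf, costOf, Fintype.sum_prod_type]
  refine Finset.sum_le_sum fun e _ => ?_
  have hnn : ∀ j, 0 ≤ Z.indicator I.subdivide.cost (e, j) :=
    fun j => Set.indicator_nonneg (fun f _ => I.subdivide.cost_nonneg f) (e, j)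
  refine Set.indicator_apply_le' ?_ fun _ => Finset.sum_nonneg fun j _ => hnn j
  rintro ⟨⟨e, j⟩, hf, rfl⟩
  calc I.cost e = Z.indicator I.subdivide.cost (e, j) := by rw [Set.indicator_of_mem hf]; rfl
    _ ≤ ∑ j, Z.indicator I.subdivide.cost (e, j) :=
      Finset.single_le_sum (fun j _ => hnn j) (Finset.mem_univ j)

theorem exists_subdivide_walk_subNode (e : E) (k : Fin (r + 2)) :
    ∃ p : I.subdivide.Walk (I.subNode e 0) (I.subNode e k), ∀ f ∈ p.edges, f.1 = e := by
  induction k using Fin.induction with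
  | zero => exact ⟨.nil _, by simp⟩
  | succ k ih =>
    obtain ⟨p, hp⟩ := ih
    let last : I.subdivide.Walk (I.subNode e k.castSucc) (I.subNode e k.succ) :=
      .cons (e, k) (I.subdivide.joins_fst_snd (e, k)) (.nil _)
    refine ⟨p.append last, fun f hf => ?_⟩
    rcases List.mem_append.1 (Walk.edges_append p last ▸ hf) with hf | hf
    · exact hp f hf
    · rw [List.mem_singleton.1 hf]

theorem exists_subdivide_walk_of_joins {e : E} {a b : V} (h : I.Joins e a b) :
    ∃ p : I.subdivide.Walk (Sum.inl a) (Sum.inl b), ∀ f ∈ p.edges, f.1 = e := by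
  obtain ⟨p, hp⟩ : ∃ p : I.subdivide.Walk (Sum.inl (I.fst e)) (Sum.inl (I.snd e)),
      ∀ f ∈ p.edges, f.1 = e :=
    I.subNode_last e ▸ I.exists_subdivide_walk_subNode e (Fin.last (r + 1))
  rcases h with ⟨rfl, rfl⟩ | ⟨rfl, rfl⟩
  · exact ⟨p, hp⟩
  · exact ⟨p.reverse, fun f hf => hp f (by simpa using hf)⟩

theorem exists_subdivide_walk {a b : V} (p : I.Walk a b) :
    ∃ q : I.subdivide.Walk (Sum.inl a) (Sum.inl b), ∀ f ∈ q.edges, f.1 ∈ p.edges := by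
  induction p with
  | nil a => exact ⟨.nil _, by simp⟩
  | cons e h p ih =>
    obtain ⟨q, hq⟩ := ih
    obtain ⟨q', hq'⟩ := I.exists_subdivide_walk_of_joins h
    refine ⟨q'.append q, fun f hf => ?_⟩
    rcases List.mem_append.1 (Walk.edges_append q' q ▸ hf) with hf | hf
    · exact hq' f hf ▸ List.mem_cons_self
    · exact List.mem_cons_of_mem _ (hq f hf)

variable {I} in
theorem IsFeasible.unsubdivide {k : ℕ} {Z : Set (E × Fin (r + 1))}
    (h : I.subdivide.IsFeasible k Z) : I.IsFeasible k (unsubdivide Z) := by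
  rintro i ⟨P, -, hPZ, hdisj⟩
  choose Q hQ using fun j => I.exists_subdivide_walk (P j)
  exact h i (.of_walks Q (fun j f hf hZ => hPZ j f.1 (hQ j f hf) ⟨f, hZ, rfl⟩)
    fun j j' hj f hf hf' => hdisj j j' hj (hQ j f hf) (hQ j' f hf'))

end Subdivision

end MulticutInstance

section RightDerivative

open Set Filter Topology

theorem hasDerivWithinAt_min_const (h ρ : ℝ) :
    HasDerivWithinAt (fun t => min t h) (if ρ < h then 1 else 0) (Ici ρ) ρ := by
  split_ifs with hlt
  · refine ((hasDerivAt_id ρ).congr_of_eventuallyEq ?_).hasDerivWithinAt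
    filter_upwards [Iio_mem_nhds hlt] with t ht
    exact min_eq_left (le_of_lt ht)
  · exact (hasDerivWithinAt_const ρ (Ici ρ) h).congr
      (fun t ht => min_eq_right ((not_lt.1 hlt).trans ht)) (min_eq_right (not_lt.1 hlt))

section Monotone

variable {f f' : ℝ → ℝ} {a b t : ℝ} (hf : ContinuousOn f (Icc a b))
  (hf' : ∀ s ∈ Ico a b, HasDerivWithinAt f (f' s) (Ici s) s) (h0 : ∀ s ∈ Ico a b, 0 ≤ f' s)
include hf hf' h0

theorem monotoneOn_Icc_of_right_deriv_nonneg : MonotoneOn f (Icc a b) := by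
  intro u hu v hv huv
  exact image_le_of_deriv_right_le_deriv_boundary (f := fun _ => f u) (f' := fun _ => 0)
    continuousOn_const (fun s _ => hasDerivWithinAt_const s _ _) le_rfl
    (hf.mono (Icc_subset_Icc hu.1 hv.2)) (fun s hs => hf' s ⟨hu.1.trans hs.1, hs.2.trans_le hv.2⟩)
    (fun s hs => h0 s ⟨hu.1.trans hs.1, hs.2.trans_le hv.2⟩) (right_mem_Icc.2 huv)

theorem lt_of_right_deriv_nonneg_of_pos (ht : t ∈ Ico a b) (hpos : 0 < f' t) : f a < f b := by
  have hmono := monotoneOn_Icc_of_right_deriv_nonneg hf hf' h0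
  have hslope : ∀ᶠ s in 𝓝[>] t, 0 < slope f t s :=
    ((hasDerivWithinAt_iff_tendsto_slope' self_notMem_Ioi).1
      (hasDerivWithinAt_Ioi_iff_Ici.2 (hf' t ht))).eventually (lt_mem_nhds hpos)
  obtain ⟨s, hs, hts, hsb⟩ := (hslope.and (Ioo_mem_nhdsGT ht.2)).exists
  have hlt : f t < f s := by
    rwa [slope_def_field, div_pos_iff_of_pos_right (sub_pos.2 hts), sub_pos] at hs
  have hab := ht.1.trans ht.2.le
  calc f a ≤ f t := hmono (left_mem_Icc.2 hab) (Ico_subset_Icc_self ht) ht.1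
    _ < f s := hlt
    _ ≤ f b := hmono ⟨ht.1.trans hts.le, hsb.le⟩ (right_mem_Icc.2 hab) hsb.le

end Monotone

section Count

variable {f f' M : ℝ → ℝ} {N : ℝ → ℕ} {B : ℝ} (hM : ContinuousOn M (Icc 0 1))
  (hM' : ∀ s ∈ Ico (0 : ℝ) 1, HasDerivWithinAt M (N s) (Ici s) s) (hM1 : M 1 - M 0 ≤ 1)
include hM hM' hM1

theorem exists_count_le_one : ∃ t ∈ Ico (0 : ℝ) 1, N t ≤ 1 := by
  by_contra! hN
  have hmono : MonotoneOn (fun s => M s - 2 * s) (Icc 0 1) :=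
    monotoneOn_Icc_of_right_deriv_nonneg (f' := fun s => N s - 2) (by fun_prop)
      (fun s hs => (hM' s hs).sub (by simpa using ((hasDerivAt_id s).const_mul 2).hasDerivWithinAt))
      fun s hs => sub_nonneg.2 (by exact_mod_cast hN s hs)
  have := hmono (left_mem_Icc.2 zero_le_one) (right_mem_Icc.2 zero_le_one) zero_le_one
  simp only at this
  linarith

/-- On the radii with count at least `2`, the term `B * M` makes up for `2 * B`. -/
theorem exists_count_le_one_and_deriv_le (hf : ContinuousOn f (Icc 0 1))
    (hf' : ∀ s ∈ Ico (0 : ℝ) 1, HasDerivWithinAt f (f' s) (Ici s) s)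
    (h0 : ∀ s ∈ Ico (0 : ℝ) 1, 0 ≤ f' s) (hB : f 1 - f 0 ≤ B) :
    ∃ s ∈ Ico (0 : ℝ) 1, N s ≤ 1 ∧ f' s ≤ 2 * B := by
  by_contra! hbad
  have hB0 : 0 ≤ B := (sub_nonneg.2 (monotoneOn_Icc_of_right_deriv_nonneg hf hf' h0
    (left_mem_Icc.2 zero_le_one) (right_mem_Icc.2 zero_le_one) zero_le_one)).trans hB
  obtain ⟨t, ht, hNt⟩ := exists_count_le_one hM hM' hM1
  have hlt := lt_of_right_deriv_nonneg_of_pos (a := 0) (b := 1)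
    (f := fun s => f s + B * M s - 2 * B * s) (f' := fun s => f' s + B * N s - 2 * B) (by fun_prop)
    (fun s hs => ((hf' s hs).add ((hM' s hs).const_mul B)).sub
      (by simpa using ((hasDerivAt_id s).const_mul (2 * B)).hasDerivWithinAt))
    (fun s hs => by
      have hBN : 0 ≤ B * N s := by positivity
      by_cases hN : N s ≤ 1
      · linarith [hbad s hs hN]
      · have hN2 : (2 : ℝ) ≤ N s := by exact_mod_cast not_le.1 hN
        linarith [h0 s hs, mul_le_mul_of_nonneg_left hN2 hB0])
    ht (by
      have hBN : 0 ≤ B * N t := by positivity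
      linarith [hbad t ht hNt])
  have := mul_le_mul_of_nonneg_left hM1 hB0
  linarith

end Count

end RightDerivative

section LogLog

open Set Real

variable {v K R : ℝ}

theorem one_le_log_exp_mul_div (hv : 0 < v) (hvK : v ≤ K) : 1 ≤ log (exp 1 * K / v) := by
  rw [le_log_iff_exp_le (by have := hv.trans_le hvK; positivity), le_div_iff₀ hv]
  exact mul_le_mul_of_nonneg_left hvK (exp_pos 1).le

theorem one_le_log_exp_mul (hR : 1 ≤ R) : 1 ≤ log (exp 1 * R) := by
  simpa using one_le_log_exp_mul_div one_pos hR

theorem log_log_exp_mul_div_mem_Icc (hv : 0 < v) (hvK : v ≤ K) (hKR : K ≤ R * v) :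
    log (log (exp 1 * K / v)) ∈ Icc 0 (log (log (exp 1 * R))) := by
  have h1 := one_le_log_exp_mul_div hv hvK
  have hK := hv.trans_le hvK
  refine ⟨log_nonneg h1, log_le_log (by positivity) (log_le_log (by positivity) ?_)⟩
  rw [mul_div_assoc]
  exact mul_le_mul_of_nonneg_left ((div_le_iff₀ hv).2 hKR) (exp_pos 1).le

theorem monotoneOn_mul_log_exp_mul_div (K : ℝ) :
    MonotoneOn (fun v => v * log (exp 1 * K / v)) (Icc 0 K) := by
  rcases le_or_gt K 0 with hK | hK
  · exact (subsingleton_Icc_of_ge hK).monotoneOn _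
  have heq : ∀ v, v * log (exp 1 * K / v) = v * (1 + log K) + negMulLog v := by
    intro v
    rcases eq_or_ne v 0 with rfl | hv
    · simp
    · rw [log_div (by positivity) hv, log_mul (by positivity) hK.ne', log_exp, negMulLog]
      ring
  simp only [heq]
  have hderiv : ∀ v ≠ 0, HasDerivAt (fun v => v * (1 + log K) + negMulLog v)
      (log K - log v) v := fun v hv =>
    (((hasDerivAt_id v).mul_const (1 + log K)).add (hasDerivAt_negMulLog hv)).congr_deriv (by ring)
  refine monotoneOn_of_deriv_nonneg (convex_Icc 0 K)
    ((continuous_id.mul_const _).add continuous_negMulLog).continuousOn ?_ ?_ <;>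
    rw [interior_Icc] <;> intro v hv
  · exact (hderiv v hv.1.ne').differentiableAt.differentiableWithinAt
  · rw [(hderiv v hv.1.ne').deriv, sub_nonneg]
    exact log_le_log hv.1 hv.2.le

/-- The bound on the cost of a cut around a region of volume `W` in a graph of volume `K`, where `R`
bounds the ratio of the largest volume to the smallest one. -/
noncomputable def cutBound (R K W : ℝ) : ℝ := 4 * W * log (exp 1 * K / W) * log (log (exp 1 * R))

theorem cutBound_eq (R K W : ℝ) :
    cutBound R K W = 4 * log (log (exp 1 * R)) * (W * log (exp 1 * K / W)) := by
  rw [cutBound]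
  ring

theorem monotoneOn_cutBound (hR : 1 ≤ R) (K : ℝ) : MonotoneOn (cutBound R K) (Icc 0 K) := by
  intro v hv w hw hvw
  rw [cutBound_eq, cutBound_eq]
  have hL : 0 ≤ log (log (exp 1 * R)) := log_nonneg (one_le_log_exp_mul hR)
  exact mul_le_mul_of_nonneg_left (monotoneOn_mul_log_exp_mul_div K hv hw hvw) (by positivity)

section Deriv

variable {V : ℝ → ℝ} {s : Set ℝ} {t v' : ℝ}

theorem continuousOn_log_log_exp_mul_div (hV : ContinuousOn V s) (hpos : ∀ t ∈ s, 0 < V t)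
    (hK : ∀ t ∈ s, V t ≤ K) : ContinuousOn (fun t => log (log (exp 1 * K / V t))) s := by
  have hlog : ∀ t ∈ s, 0 < log (exp 1 * K / V t) := fun t ht =>
    one_pos.trans_le (one_le_log_exp_mul_div (hpos t ht) (hK t ht))
  exact ((continuousOn_const.div hV fun t ht => (hpos t ht).ne').log fun t ht =>
    (div_pos (mul_pos (exp_pos 1) ((hpos t ht).trans_le (hK t ht))) (hpos t ht)).ne').log
    fun t ht => (hlog t ht).ne'

theorem hasDerivWithinAt_log_log_exp_mul_div (hV : HasDerivWithinAt V v' s t) (hpos : 0 < V t)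
    (hK : V t ≤ K) : HasDerivWithinAt (fun t => log (log (exp 1 * K / V t)))
      (-(v' / (V t * log (exp 1 * K / V t)))) s t := by
  have hlog := one_pos.trans_le (one_le_log_exp_mul_div hpos hK)
  have hK0 := hpos.trans_le hK
  refine ((((hasDerivWithinAt_const t s (exp 1 * K)).fun_div hV hpos.ne').log
    (by positivity)).log hlog.ne').congr_deriv ?_
  field_simp
  ring

end Deriv

section Radius

variable {p M : ℝ → ℝ} {N : ℝ → ℕ} {β : ℝ} (hp : ∀ s ∈ Ico (0 : ℝ) 1, 0 ≤ p s)
  (hM : ContinuousOn M (Icc 0 1))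
  (hM' : ∀ s ∈ Ico (0 : ℝ) 1, HasDerivWithinAt M (N s) (Ici s) s) (hM1 : M 1 - M 0 ≤ 1)
include hp hM hM' hM1

/-- The mean value argument applied to `log log (e K / W) - log log (e K / U)`. -/
theorem exists_count_le_one_and_growth_le {U W : ℝ → ℝ} (hβ : 0 < β) (hR : K ≤ R * β)
    (hU : ContinuousOn U (Icc 0 1)) (hW : ContinuousOn W (Icc 0 1))
    (hU' : ∀ s ∈ Ico (0 : ℝ) 1, HasDerivWithinAt U (p s) (Ici s) s)
    (hW' : ∀ s ∈ Ico (0 : ℝ) 1, HasDerivWithinAt W (-p s) (Ici s) s)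
    (hUK : MapsTo U (Icc 0 1) (Icc β K)) (hWK : MapsTo W (Icc 0 1) (Icc β K)) :
    ∃ ρ ∈ Ico (0 : ℝ) 1, N ρ ≤ 1 ∧
      p ρ ≤ cutBound R K (U ρ) ∧ p ρ ≤ cutBound R K (W ρ) := by
  have h0 : (0 : ℝ) ∈ Icc (0 : ℝ) 1 := left_mem_Icc.2 zero_le_one
  have h1 : (1 : ℝ) ∈ Icc (0 : ℝ) 1 := right_mem_Icc.2 zero_le_one
  have hR0 : 0 ≤ R := nonneg_of_mul_nonneg_left
    ((hβ.le.trans ((hUK h0).1.trans (hUK h0).2)).trans hR) hβ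
  have hbound : ∀ {v}, v ∈ Icc β K →
      log (log (exp 1 * K / v)) ∈ Icc 0 (log (log (exp 1 * R))) := fun hv =>
    log_log_exp_mul_div_mem_Icc (hβ.trans_le hv.1) hv.2
      (hR.trans (mul_le_mul_of_nonneg_left hv.1 hR0))
  have hrate : ∀ {v}, v ∈ Icc β K → 0 < v * log (exp 1 * K / v) := fun hv =>
    mul_pos (hβ.trans_le hv.1)
      (one_pos.trans_le (one_le_log_exp_mul_div (hβ.trans_le hv.1) hv.2))
  have hnonneg : ∀ {s v}, s ∈ Ico (0 : ℝ) 1 → v ∈ Icc β K → 0 ≤ p s / (v * log (exp 1 * K / v)) :=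
    fun hs hv => div_nonneg (hp _ hs) (hrate hv).le
  obtain ⟨ρ, hρ, hNρ, hle⟩ := exists_count_le_one_and_deriv_le hM hM' hM1
    (f := fun s => log (log (exp 1 * K / W s)) - log (log (exp 1 * K / U s)))
    (f' := fun s => p s / (W s * log (exp 1 * K / W s)) + p s / (U s * log (exp 1 * K / U s)))
    (B := 2 * log (log (exp 1 * R)))
    ((continuousOn_log_log_exp_mul_div hW (fun s hs => hβ.trans_le (hWK hs).1)
      fun s hs => (hWK hs).2).sub (continuousOn_log_log_exp_mul_div hU
        (fun s hs => hβ.trans_le (hUK hs).1) fun s hs => (hUK hs).2))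
    (fun s hs => by
      obtain ⟨⟨hU0, hU1⟩, hW0, hW1⟩ := And.intro (hUK (Ico_subset_Icc_self hs))
        (hWK (Ico_subset_Icc_self hs))
      refine ((hasDerivWithinAt_log_log_exp_mul_div (hW' s hs) (hβ.trans_le hW0) hW1).sub
        (hasDerivWithinAt_log_log_exp_mul_div (hU' s hs) (hβ.trans_le hU0) hU1)).congr_deriv ?_
      ring)
    (fun s hs => add_nonneg (hnonneg hs (hWK (Ico_subset_Icc_self hs)))
      (hnonneg hs (hUK (Ico_subset_Icc_self hs))))
    (by linarith [(hbound (hWK h0)).1, (hbound (hWK h1)).2, (hbound (hUK h0)).2,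
      (hbound (hUK h1)).1])
  have hρU := hUK (Ico_subset_Icc_self hρ)
  have hρW := hWK (Ico_subset_Icc_self hρ)
  refine ⟨ρ, hρ, hNρ, ?_, ?_⟩ <;> rw [cutBound_eq]
  · linarith [(div_le_iff₀ (hrate hρU)).1 ((le_add_of_nonneg_left (hnonneg hρ hρW)).trans hle)]
  · linarith [(div_le_iff₀ (hrate hρW)).1 ((le_add_of_nonneg_right (hnonneg hρ hρU)).trans hle)]

theorem exists_radius {P : ℝ → ℝ} (hP : ContinuousOn P (Icc 0 1))
    (hP' : ∀ s ∈ Ico (0 : ℝ) 1, HasDerivWithinAt P (p s) (Ici s) s) (hP0 : P 0 = 0)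
    (hβ : 0 < β) (hK : β + P 1 ≤ K) (hR : K ≤ R * β) :
    ∃ ρ ∈ Ico (0 : ℝ) 1, N ρ ≤ 1 ∧
      p ρ ≤ cutBound R K (β + P ρ) ∧ p ρ ≤ cutBound R K (β + (P 1 - P ρ)) := by
  have hmem : ∀ s ∈ Icc (0 : ℝ) 1, 0 ≤ P s ∧ P s ≤ P 1 := fun s hs =>
    have hmono := monotoneOn_Icc_of_right_deriv_nonneg hP hP' hp
    ⟨hP0.symm.trans_le (hmono (left_mem_Icc.2 zero_le_one) hs hs.1),
      hmono hs (right_mem_Icc.2 zero_le_one) hs.2⟩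
  exact exists_count_le_one_and_growth_le hp hM hM' hM1 hβ hR
    (continuousOn_const.add hP) (continuousOn_const.add (continuousOn_const.sub hP))
    (fun s hs => (hP' s hs).const_add β) (fun s hs => ((hP' s hs).const_sub (P 1)).const_add β)
    (fun s hs => ⟨by linarith [hmem s hs], by linarith [hmem s hs]⟩)
    (fun s hs => ⟨by linarith [hmem s hs], by linarith [hmem s hs]⟩)

end Radius

end LogLog

section ClippedMass

open Set

variable {E : Type*} [Fintype E] {D : Set E} {c lo hi : E → ℝ}

/-- If every `e ∈ D` spreads the mass `c e` per unit length over the interval `[lo e, hi e]`, this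
is the mass lying below `ρ`. -/
noncomputable def clippedMass (D : Set E) (c lo hi : E → ℝ) (ρ : ℝ) : ℝ :=
  ∑ e, D.indicator (fun e => c e * (min ρ (hi e) - min ρ (lo e))) e

theorem continuous_clippedMass (D : Set E) (c lo hi : E → ℝ) :
    Continuous (clippedMass D c lo hi) := by
  refine continuous_finsetSum _ fun e _ => ?_
  by_cases he : e ∈ D
  · simp only [indicator_of_mem he]
    fun_prop
  · simp only [indicator_of_notMem he]
    fun_prop

theorem hasDerivWithinAt_clippedMass (D : Set E) (c : E → ℝ) (h : ∀ e, lo e ≤ hi e) (ρ : ℝ) :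
    HasDerivWithinAt (clippedMass D c lo hi)
      (∑ e, (D ∩ {e | lo e ≤ ρ ∧ ρ < hi e}).indicator c e) (Ici ρ) ρ := by
  refine HasDerivWithinAt.fun_sum fun e _ => ?_
  by_cases he : e ∈ D
  · simp only [indicator_of_mem he]
    refine (((hasDerivWithinAt_min_const (hi e) ρ).sub
      (hasDerivWithinAt_min_const (lo e) ρ)).const_mul (c e)).congr_deriv ?_
    have := h e
    simp only [indicator, mem_inter_iff, he, true_and, mem_ofPred_eq]
    split_ifs <;> first | (simp; done) | grind
  · simpa [he] using hasDerivWithinAt_const ρ (Ici ρ) (0 : ℝ)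

theorem sum_indicator_one (D : Set E) : ∑ e, D.indicator (1 : E → ℝ) e = D.ncard := by
  classical
  simp [ncard_eq_toFinset_card', indicator_apply, Set.toFinset]

theorem hasDerivWithinAt_clippedMass_one (D : Set E) (h : ∀ e, lo e ≤ hi e) (ρ : ℝ) :
    HasDerivWithinAt (clippedMass D 1 lo hi) (D ∩ {e | lo e ≤ ρ ∧ ρ < hi e}).ncard (Ici ρ) ρ :=
  (hasDerivWithinAt_clippedMass D 1 h ρ).congr_deriv (sum_indicator_one _)

theorem clippedMass_zero (D : Set E) (c : E → ℝ) (h0 : ∀ e, 0 ≤ lo e) (h : ∀ e, lo e ≤ hi e) :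
    clippedMass D c lo hi 0 = 0 :=
  Finset.sum_eq_zero fun e _ => indicator_apply_eq_zero.2 fun _ => by
    rw [min_eq_left (h0 e), min_eq_left ((h0 e).trans (h e)), sub_self, mul_zero]

theorem clippedMass_one (D : Set E) (c : E → ℝ) (h1 : ∀ e, hi e ≤ 1) (h : ∀ e, lo e ≤ hi e) :
    clippedMass D c lo hi 1 = ∑ e, D.indicator (fun e => c e * (hi e - lo e)) e :=
  Finset.sum_congr rfl fun e _ => by
    simp only [indicator, min_eq_right (h1 e), min_eq_right ((h e).trans (h1 e))]

theorem clippedMass_mem_Icc (hc : ∀ e, 0 ≤ c e) (h0 : ∀ e, 0 ≤ lo e) (h : ∀ e, lo e ≤ hi e) {ρ : ℝ}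
    (hρ : ρ ∈ Icc 0 1) : clippedMass D c lo hi ρ ∈ Icc 0 (clippedMass D c lo hi 1) := by
  have hmono : MonotoneOn (clippedMass D c lo hi) (Icc 0 1) :=
    monotoneOn_Icc_of_right_deriv_nonneg (continuous_clippedMass D c lo hi).continuousOn
      (fun s _ => hasDerivWithinAt_clippedMass D c h s)
      fun _ _ => Finset.sum_nonneg fun e _ => indicator_nonneg (fun e _ => hc e) e
  exact ⟨(clippedMass_zero D c h0 h).symm.trans_le (hmono (left_mem_Icc.2 zero_le_one) hρ hρ.1),
    hmono hρ (right_mem_Icc.2 zero_le_one) hρ.2⟩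

end ClippedMass

namespace MulticutInstance

open Multigraph

section Cost

variable {V E : Type*} [Fintype E] {r : ℕ} (I : MulticutInstance V E r)

theorem costOf_empty : I.costOf (∅ : Set E) = 0 := by simp [costOf]

theorem costOf_singleton (e : E) : I.costOf {e} = I.cost e := by
  classical
  simp [costOf, Set.indicator]

theorem costOf_union_le (Y Z : Set E) : I.costOf (Y ∪ Z) ≤ I.costOf Y + I.costOf Z := by
  rw [costOf, costOf, costOf, ← Finset.sum_add_distrib]
  refine Finset.sum_le_sum fun e _ => ?_
  rw [← Set.indicator_union_add_inter_apply]
  exact le_add_of_nonneg_right (Set.indicator_nonneg (fun e _ => I.cost_nonneg e) e)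

theorem costOf_sdiff_singleton {D : Set E} {e : E} (he : e ∈ D) :
    I.costOf (D \ {e}) = I.costOf D - I.cost e := by
  rw [← costOf_singleton, costOf, costOf, costOf, ← Finset.sum_sub_distrib]
  exact Finset.sum_congr rfl fun f _ =>
    congrFun (Set.indicator_sdiff (Set.singleton_subset_iff.2 he) I.cost) f

omit [Fintype E] in
theorem sSup_cost_nonneg (D : Set E) : 0 ≤ sSup (I.cost '' D) :=
  Real.sSup_nonneg (Set.forall_mem_image.2 fun e _ => I.cost_nonneg e)

variable {I} in
theorem IsAllButMax.costOf_le {D Y : Set E} (h : I.IsAllButMax D Y) :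
    I.costOf Y ≤ I.costButMax D := by
  rcases h with ⟨rfl, rfl⟩ | ⟨e, he, hmax, rfl⟩
  · simp [costButMax, costOf_empty]
  · have hle : sSup (I.cost '' D) ≤ I.cost e :=
      csSup_le ⟨_, e, he, rfl⟩ (Set.forall_mem_image.2 hmax)
    rw [I.costOf_sdiff_singleton he, costButMax]
    exact sub_le_sub_left hle _

theorem costButMax_le_of_subsingleton {D F : Set E} (h : (D \ F).Subsingleton) :
    I.costButMax D ≤ I.costOf (D ∩ F) := by
  suffices hD : I.costOf (D \ F) ≤ sSup (I.cost '' D) by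
    have := I.costOf_union_le (D ∩ F) (D \ F)
    rw [Set.inter_union_sdiff] at this
    rw [costButMax]
    linarith
  rcases h.eq_empty_or_singleton with h0 | ⟨e, he⟩
  · rw [h0, costOf_empty]
    exact I.sSup_cost_nonneg D
  · rw [he, costOf_singleton]
    have heD : e ∈ D \ F := he ▸ Set.mem_singleton e
    exact le_csSup (Set.toFinite _).bddAbove ⟨e, heD.1, rfl⟩

end Cost

section Weight

variable {V E : Type*} [Fintype E] {r : ℕ} (I : MulticutInstance V E r) (x : E → ℝ)

/-- `∑_{e ∈ D} c_e x_e`, the part of the LP value that lies on the edge set `D`. -/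
noncomputable def weight (D : Set E) : ℝ := ∑ e, D.indicator (fun e => I.cost e * x e) e

theorem volX_eq (S : Set V) : I.volX x S = I.beta x + I.weight x (I.edgesIn S) := rfl

theorem weight_sdiff_add {D D' : Set E} (h : D' ⊆ D) :
    I.weight x (D \ D') + I.weight x D' = I.weight x D := by
  rw [weight, weight, weight, ← Finset.sum_add_distrib]
  exact Finset.sum_congr rfl fun e _ => by
    rw [Set.indicator_sdiff h, Pi.sub_apply, sub_add_cancel]

variable {x} (hx : ∀ e, 0 ≤ x e)
include hx

theorem weight_nonneg (D : Set E) : 0 ≤ I.weight x D :=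
  Finset.sum_nonneg fun e _ =>
    Set.indicator_nonneg (fun e _ => mul_nonneg (I.cost_nonneg e) (hx e)) e

theorem weight_mono {D D' : Set E} (h : D ⊆ D') : I.weight x D ≤ I.weight x D' :=
  Finset.sum_le_sum fun e _ => Set.indicator_le_indicator_of_subset h
    (fun e => mul_nonneg (I.cost_nonneg e) (hx e)) e

theorem weight_le_lpValue (D : Set E) : I.weight x D ≤ I.lpValue x := by
  refine (I.weight_mono hx (Set.subset_univ D)).trans (le_of_eq ?_)
  simp [weight, lpValue]

theorem lpValue_nonneg : 0 ≤ I.lpValue x :=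
  (I.weight_nonneg hx ∅).trans (I.weight_le_lpValue hx ∅)

theorem beta_nonneg : 0 ≤ I.beta x := div_nonneg (I.lpValue_nonneg hx) (Nat.cast_nonneg r)

omit hx in
theorem mul_beta (hr : r ≠ 0) : r * I.beta x = I.lpValue x :=
  mul_div_cancel₀ _ (Nat.cast_ne_zero.2 hr)

theorem volX_le (hr : r ≠ 0) (S : Set V) : I.volX x S ≤ (r + 1) * I.beta x := by
  linarith [I.weight_le_lpValue hx (I.edgesIn S), I.mul_beta (x := x) hr, I.volX_eq x S]

theorem volX_mono {S S' : Set V} (h : S ⊆ S') : I.volX x S ≤ I.volX x S' :=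
  add_le_add le_rfl (I.weight_mono hx (I.edgesIn_mono h))

end Weight

end MulticutInstance

namespace Multigraph

variable {V E : Type*} {G : Multigraph V E} {w : E → ℝ} {z : V} {ρ : ℝ} {e : E}

/-- The part of the edge `e` that the volume of the ball of radius `ρ` around `z` accounts for. -/
noncomputable def ballShare (G : Multigraph V E) (w : E → ℝ) (z : V) (ρ : ℝ) (e : E) : ℝ :=
  if G.farDist w z e ≤ ρ then G.dist w (G.fst e) (G.snd e)
  else if G.nearDist w z e ≤ ρ then ρ - G.nearDist w z e else 0

/-- The part of the edge `e` that the volume of the complement of the ball of radius `ρ` around `z`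
accounts for. The far end of a boundary edge may have distance more than `1` from `z`, so its
distance is not truncated here. -/
noncomputable def outShare (G : Multigraph V E) (w : E → ℝ) (z : V) (ρ : ℝ) (e : E) : ℝ :=
  if ρ < G.nearDist w z e then G.dist w (G.fst e) (G.snd e)
  else if ρ < G.farDist w z e then max (G.dist w z (G.fst e)) (G.dist w z (G.snd e)) - ρ else 0

section Share

variable (hw : ∀ e, 0 ≤ w e)
include hw

theorem max_dist_mem_Icc (h : G.nearDist w z e < 1) :
    max (G.dist w z (G.fst e)) (G.dist w z (G.snd e)) ∈
      Set.Icc (G.farDist w z e) (G.nearDist w z e + w e) := by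
  have hj := G.joins_fst_snd e
  rcases le_total (G.truncDist w z (G.fst e)) (G.truncDist w z (G.snd e)) with hle | hle
  · rw [nearDist, min_eq_left hle] at h ⊢
    rw [farDist, max_eq_right hle, ← truncDist_eq_dist h]
    have := hj.dist_mem_Icc hw h
    exact ⟨le_max_of_le_right this.1, max_le (le_add_of_nonneg_right (hw e)) this.2⟩
  · rw [nearDist, min_eq_right hle] at h ⊢
    rw [farDist, max_eq_left hle, ← truncDist_eq_dist h]
    have := hj.symm.dist_mem_Icc hw h
    exact ⟨le_max_of_le_left this.1, max_le this.2 (le_add_of_nonneg_right (hw e))⟩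

theorem le_ballShare :
    min ρ (G.farDist w z e) - min ρ (G.nearDist w z e) ≤ G.ballShare w z ρ e := by
  have hnf := G.nearDist_le_farDist w z e
  rw [ballShare]
  split_ifs with hfar hnear
  · rw [min_eq_right hfar, min_eq_right (hnf.trans hfar)]
    exact farDist_sub_nearDist_le_dist G z e hw
  · rw [min_eq_left (not_le.1 hfar).le, min_eq_right hnear]
  · rw [min_eq_left (not_le.1 hfar).le, min_eq_left (not_le.1 hnear).le, sub_self]

theorem ballShare_le : G.ballShare w z ρ e ≤ {e | G.nearDist w z e ≤ ρ}.indicator w e := by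
  have hnf := G.nearDist_le_farDist w z e
  rw [ballShare]
  split_ifs with hfar hnear
  · rw [Set.indicator_of_mem (by exact hnf.trans hfar)]
    exact (G.joins_fst_snd e).dist_le hw
  · rw [Set.indicator_of_mem (by exact hnear)]
    linarith [farDist_sub_nearDist_le_dist G z e hw, (G.joins_fst_snd e).dist_le hw]
  · exact Set.indicator_nonneg (fun e _ => hw e) e

theorem le_outShare (hρ : ρ < 1) : G.farDist w z e - G.nearDist w z e -
    (min ρ (G.farDist w z e) - min ρ (G.nearDist w z e)) ≤ G.outShare w z ρ e := by
  have hnf := G.nearDist_le_farDist w z e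
  rw [outShare]
  split_ifs with hnear hfar
  · rw [min_eq_left hnear.le, min_eq_left (hnear.le.trans hnf), sub_self, sub_zero]
    exact farDist_sub_nearDist_le_dist G z e hw
  · rw [min_eq_left hfar.le, min_eq_right (not_lt.1 hnear)]
    linarith [(max_dist_mem_Icc hw ((not_lt.1 hnear).trans_lt hρ)).1]
  · rw [min_eq_right (not_lt.1 hfar), min_eq_right (not_lt.1 hnear), sub_self]

theorem outShare_le (hρ : ρ < 1) :
    G.outShare w z ρ e ≤ {e | ρ < G.farDist w z e}.indicator w e := by
  have hnf := G.nearDist_le_farDist w z e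
  rw [outShare]
  split_ifs with hnear hfar
  · rw [Set.indicator_of_mem (by exact hnear.trans_le hnf)]
    exact (G.joins_fst_snd e).dist_le hw
  · rw [Set.indicator_of_mem (by exact hfar)]
    linarith [(max_dist_mem_Icc hw ((not_lt.1 hnear).trans_lt hρ)).2]
  · exact Set.indicator_nonneg (fun e _ => hw e) e

end Share

end Multigraph

namespace MulticutInstance

open Multigraph

section Regions

variable {V E : Type*} {r : ℕ} {I : MulticutInstance V E r} {x : E → ℝ} {y : Fin r → E → ℝ}
  {S : Set V} {i : Fin r} {z : V} {ρ : ℝ}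

theorem sdiff_ballIn : S \ I.ballIn x y S i z ρ = I.ballOut x y S i z ρ := by
  rw [ballIn, Set.inter_comm, Set.sdiff_self_inter, ballOut]

theorem sdiff_ballOut : S \ I.ballOut x y S i z ρ = I.ballIn x y S i z ρ := by
  rw [ballOut, Set.sdiff_sdiff_right_self, Set.inter_comm, ballIn]

section Radius

variable (h0 : 0 ≤ ρ) (h1 : ρ < 1) {e : E}
include h0 h1

theorem mem_edgesIn_ballIn_iff : e ∈ I.edgesIn (I.ballIn x y S i z ρ) ↔
    e ∈ I.edgesIn S ∧ I.farDist (lengths x y i) z e ≤ ρ := by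
  simp only [edgesIn, ballIn, farDist, Set.mem_ofPred_eq, Set.mem_inter_iff, mem_ball_iff h0 h1,
    max_le_iff]
  tauto

theorem mem_edgesIn_ballOut_iff : e ∈ I.edgesIn (I.ballOut x y S i z ρ) ↔
    e ∈ I.edgesIn S ∧ ρ < I.nearDist (lengths x y i) z e := by
  simp only [edgesIn, ballOut, nearDist, Set.mem_ofPred_eq, Set.mem_sdiff, mem_ball_iff h0 h1,
    lt_min_iff, not_le]
  tauto

theorem mem_cut_ballIn_iff : e ∈ I.cut S (I.ballIn x y S i z ρ) ↔
    e ∈ I.edgesIn S ∧ I.nearDist (lengths x y i) z e ≤ ρ ∧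
      ρ < I.farDist (lengths x y i) z e := by
  simp only [cut, ballIn, edgesIn, nearDist, farDist, Set.mem_ofPred_eq, Set.mem_sdiff,
    Set.mem_inter_iff, mem_ball_iff h0 h1, min_le_iff, ← not_le, max_le_iff]
  tauto

end Radius

end Regions

section Volume

variable {V E : Type*} [Fintype E] {r : ℕ} {I : MulticutInstance V E r} {F : Set E} {x : E → ℝ}
  {y : Fin r → E → ℝ} {S : Set V} {i : Fin r} {z : V} {ρ : ℝ} {e : E}

/-- The volume that is charged when the region `A` is carved out of `S`: the edges of `E(S)` that do
not survive in `S \ A`. -/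
noncomputable def regionVol (I : MulticutInstance V E r) (x : E → ℝ) (S A : Set V) : ℝ :=
  I.beta x + I.weight x (I.edgesIn S \ I.edgesIn (S \ A))

section Share

variable (hw : ∀ e, 0 ≤ lengths x y i e) (h0 : 0 ≤ ρ) (h1 : ρ < 1)
include h0 h1

theorem vol_eq : I.vol F x y S i z ρ = I.beta x + ∑ e, (F ∩ I.edgesIn S).indicator
    (fun e => I.cost e * I.ballShare (lengths x y i) z ρ e) e := by
  classical
  rw [vol, add_assoc, add_assoc, ← Finset.sum_add_distrib, ← Finset.sum_add_distrib]
  congr! 2 with e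
  simp only [Set.indicator, Set.mem_inter_iff, Set.mem_ofPred_eq, edgesIn, ballIn, ballOut,
    Set.mem_sdiff, mem_ball_iff h0 h1, ballShare, farDist, nearDist, max_le_iff, min_le_iff, ell]
  by_cases hf : I.truncDist (lengths x y i) z (I.fst e) ≤ ρ <;>
    by_cases hs : I.truncDist (lengths x y i) z (I.snd e) ≤ ρ
  · simp [hf, hs]
  · simp [hf, hs, min_eq_left (hf.trans (not_le.1 hs).le), ← truncDist_eq_dist (hf.trans_lt h1)]
  · simp [hf, hs, min_eq_right (hs.trans (not_le.1 hf).le), ← truncDist_eq_dist (hs.trans_lt h1),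
      and_comm (a := I.snd e ∈ S)]
  · simp [hf, hs]

include hw

theorem volOut_eq : I.volOut F x y S i z ρ = I.beta x + ∑ e, (F ∩ I.edgesIn S).indicator
    (fun e => I.cost e * I.outShare (lengths x y i) z ρ e) e := by
  classical
  rw [volOut, add_assoc, add_assoc, ← Finset.sum_add_distrib, ← Finset.sum_add_distrib]
  congr! 2 with e
  simp only [Set.indicator, Set.mem_inter_iff, Set.mem_ofPred_eq, edgesIn, ballIn, ballOut,
    Set.mem_sdiff, mem_ball_iff h0 h1, outShare, farDist, nearDist, ← not_le, max_le_iff,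
    min_le_iff, ell]
  have hle : ∀ {a b}, I.truncDist (lengths x y i) z a ≤ ρ → ¬I.truncDist (lengths x y i) z b ≤ ρ →
      I.Joins e a b → I.dist (lengths x y i) z a ≤ I.dist (lengths x y i) z b :=
    fun ha hb hj => (truncDist_eq_dist (ha.trans_lt h1)).ge.trans
      ((ha.trans (not_le.1 hb).le).trans (hj.dist_mem_Icc hw (ha.trans_lt h1)).1)
  by_cases hf : I.truncDist (lengths x y i) z (I.fst e) ≤ ρ <;>
    by_cases hs : I.truncDist (lengths x y i) z (I.snd e) ≤ ρ
  · simp [hf, hs]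
  · simp [hf, hs, max_eq_right (hle hf hs (I.joins_fst_snd e))]
  · simp [hf, hs, max_eq_left (hle hs hf (I.joins_fst_snd e).symm), and_comm (a := I.snd e ∈ S)]
  · simp [hf, hs]

end Share

variable (h : I.IsRoundable F x y)
include h

theorem IsRoundable.lengths_nonneg (i : Fin r) (e : E) : 0 ≤ lengths x y i e :=
  add_nonneg (h.x_nonneg e) (h.y_nonneg i e)

theorem IsRoundable.lengths_eq_x (he : e ∈ F) : lengths x y i e = x e := by
  rw [lengths, h.y_eq_zero i e he, add_zero]

theorem IsRoundable.lengths_eq_y (he : e ∉ F) : lengths x y i e = y i e := by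
  rw [lengths, h.x_eq_zero e he, zero_add]

theorem IsRoundable.sum_cost_mul_le_weight (D : Set E) {D' : Set E} {f : E → ℝ}
    (hf : ∀ e, f e ≤ D'.indicator (lengths x y i) e) :
    ∑ e, (F ∩ D).indicator (fun e => I.cost e * f e) e ≤ I.weight x (D ∩ D') := by
  refine Finset.sum_le_sum fun e _ => Set.indicator_apply_le' (fun he => ?_) fun _ =>
    Set.indicator_nonneg (fun e _ => mul_nonneg (I.cost_nonneg e) (h.x_nonneg e)) e
  have hfe := hf e
  by_cases heD' : e ∈ D'
  · rw [Set.indicator_of_mem heD', h.lengths_eq_x he.1] at hfe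
    have hmem : e ∈ D ∩ D' := ⟨he.2, heD'⟩
    rw [Set.indicator_of_mem hmem]
    exact mul_le_mul_of_nonneg_left hfe (I.cost_nonneg e)
  · rw [Set.indicator_of_notMem heD'] at hfe
    rw [Set.indicator_of_notMem fun hD : e ∈ D ∩ D' => heD' hD.2]
    exact mul_nonpos_of_nonneg_of_nonpos (I.cost_nonneg e) hfe

theorem IsRoundable.regionVol_le_volX {A : Set V} : I.regionVol x S A ≤ I.volX x S :=
  add_le_add_right (I.weight_mono h.x_nonneg Set.sdiff_subset) _

section Bounds

variable (S i z) (h0 : 0 ≤ ρ) (h1 : ρ < 1)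
include h0 h1

theorem IsRoundable.le_vol : I.beta x + clippedMass (F ∩ I.edgesIn S) I.cost
    (I.nearDist (lengths x y i) z) (I.farDist (lengths x y i) z) ρ ≤ I.vol F x y S i z ρ := by
  rw [vol_eq h0 h1, clippedMass]
  gcongr with e
  · exact I.cost_nonneg e
  · exact le_ballShare (h.lengths_nonneg i)

theorem IsRoundable.le_volOut : I.beta x +
    (clippedMass (F ∩ I.edgesIn S) I.cost (I.nearDist (lengths x y i) z)
        (I.farDist (lengths x y i) z) 1 -
      clippedMass (F ∩ I.edgesIn S) I.cost (I.nearDist (lengths x y i) z)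
        (I.farDist (lengths x y i) z) ρ) ≤ I.volOut F x y S i z ρ := by
  rw [volOut_eq (h.lengths_nonneg i) h0 h1, clippedMass_one _ _ (I.farDist_le_one _ z)
    (I.nearDist_le_farDist _ z), clippedMass, ← Finset.sum_sub_distrib]
  gcongr with e
  rw [← Pi.sub_apply, ← Set.indicator_sub']
  refine Set.indicator_le_indicator ?_
  rw [Pi.sub_apply, ← mul_sub]
  exact mul_le_mul_of_nonneg_left (le_outShare (h.lengths_nonneg i) h1) (I.cost_nonneg e)

theorem IsRoundable.beta_le_vol : I.beta x ≤ I.vol F x y S i z ρ :=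
  (le_add_of_nonneg_right (clippedMass_mem_Icc I.cost_nonneg (I.nearDist_nonneg _ z)
    (I.nearDist_le_farDist _ z) ⟨h0, h1.le⟩).1).trans (h.le_vol S i z h0 h1)

theorem IsRoundable.beta_le_volOut : I.beta x ≤ I.volOut F x y S i z ρ :=
  (le_add_of_nonneg_right (sub_nonneg.2 (clippedMass_mem_Icc I.cost_nonneg (I.nearDist_nonneg _ z)
    (I.nearDist_le_farDist _ z) ⟨h0, h1.le⟩).2)).trans (h.le_volOut S i z h0 h1)

theorem IsRoundable.vol_le : I.vol F x y S i z ρ ≤ I.regionVol x S (I.ballIn x y S i z ρ) := by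
  rw [vol_eq h0 h1, regionVol, sdiff_ballIn]
  refine add_le_add_right ((h.sum_cost_mul_le_weight (I.edgesIn S) fun e =>
    ballShare_le (h.lengths_nonneg i)).trans (I.weight_mono h.x_nonneg fun e he => ?_)) _
  exact ⟨he.1, fun heo => he.2.not_gt ((mem_edgesIn_ballOut_iff h0 h1).1 heo).2⟩

theorem IsRoundable.volOut_le :
    I.volOut F x y S i z ρ ≤ I.regionVol x S (I.ballOut x y S i z ρ) := by
  rw [volOut_eq (h.lengths_nonneg i) h0 h1, regionVol, sdiff_ballOut]
  refine add_le_add_right ((h.sum_cost_mul_le_weight (I.edgesIn S) fun e =>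
    outShare_le (h.lengths_nonneg i) h1).trans (I.weight_mono h.x_nonneg fun e he => ?_)) _
  exact ⟨he.1, fun heb => he.2.not_ge ((mem_edgesIn_ballIn_iff h0 h1).1 heb).2⟩

end Bounds

end Volume

section GoodRadius

variable {V E : Type*} [Fintype E] {r : ℕ} {I : MulticutInstance V E r} {F : Set E} {x : E → ℝ}
  {y : Fin r → E → ℝ} (S : Set V) (i : Fin r) {ρ : ℝ}

/-- The edges whose ends are separated by the ball of radius `ρ` around `z`. -/
def crossing (I : MulticutInstance V E r) (x : E → ℝ) (y : Fin r → E → ℝ) (i : Fin r) (z : V)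
    (ρ : ℝ) : Set E :=
  {e | I.nearDist (lengths x y i) z e ≤ ρ ∧ ρ < I.farDist (lengths x y i) z e}

theorem costButMax_cut_ballIn_le (z : V) (h0 : 0 ≤ ρ) (h1 : ρ < 1)
    (hN : ((I.edgesIn S \ F) ∩ I.crossing x y i z ρ).ncard ≤ 1) :
    I.costButMax (I.cut S (I.ballIn x y S i z ρ)) ≤
      I.costOf ((F ∩ I.edgesIn S) ∩ I.crossing x y i z ρ) := by
  have hcut : I.cut S (I.ballIn x y S i z ρ) = I.edgesIn S ∩ I.crossing x y i z ρ :=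
    Set.ext fun e => mem_cut_ballIn_iff h0 h1
  rw [hcut, Set.inter_assoc, Set.inter_comm F]
  refine I.costButMax_le_of_subsingleton ?_
  rw [Set.inter_sdiff_right_comm]
  exact Set.ncard_le_one_iff_subsingleton.1 hN

variable (h : I.IsRoundable F x y)
include h

theorem IsRoundable.farDist_sub_nearDist_le (z : V) (e : E) :
    I.farDist (lengths x y i) z e - I.nearDist (lengths x y i) z e ≤ lengths x y i e :=
  (I.farDist_sub_nearDist _ z e).trans_le
    (abs_truncDist_sub_le I.toMultigraph z e (h.lengths_nonneg i))

theorem IsRoundable.clippedMass_cost_le (z : V) :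
    clippedMass (F ∩ I.edgesIn S) I.cost (I.nearDist (lengths x y i) z)
      (I.farDist (lengths x y i) z) 1 ≤ I.weight x (I.edgesIn S) := by
  rw [clippedMass_one _ _ (I.farDist_le_one _ z) (I.nearDist_le_farDist _ z)]
  refine (h.sum_cost_mul_le_weight (I.edgesIn S) (i := i) (D' := Set.univ) fun e => ?_).trans_eq
    (by rw [Set.inter_univ])
  rw [Set.indicator_univ]
  exact h.farDist_sub_nearDist_le i z e

theorem IsRoundable.clippedMass_one_le (z : V) :
    clippedMass (I.edgesIn S \ F) 1 (I.nearDist (lengths x y i) z)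
      (I.farDist (lengths x y i) z) 1 ≤ 1 := by
  rw [clippedMass_one _ _ (I.farDist_le_one _ z) (I.nearDist_le_farDist _ z)]
  refine (Finset.sum_le_sum fun e _ => ?_).trans (h.budget i)
  refine Set.indicator_apply_le' (fun he => ?_) fun _ => h.y_nonneg i e
  rw [Pi.one_apply, one_mul, ← h.lengths_eq_y he.2]
  exact h.farDist_sub_nearDist_le i z e

theorem IsRoundable.clippedMass_one_sub_le (z : V) :
    clippedMass (I.edgesIn S \ F) 1 (I.nearDist (lengths x y i) z)
        (I.farDist (lengths x y i) z) 1 -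
      clippedMass (I.edgesIn S \ F) 1 (I.nearDist (lengths x y i) z)
        (I.farDist (lengths x y i) z) 0 ≤ 1 := by
  rw [clippedMass_zero _ _ (I.nearDist_nonneg _ z) (I.nearDist_le_farDist _ z), sub_zero]
  exact h.clippedMass_one_le S i z

theorem IsRoundable.exists_goodRadius_of_beta_eq_zero (hβ : I.beta x = 0) :
    ∃ ρ, I.GoodRadius F x y S i ρ := by
  have hr : r ≠ 0 := i.pos.ne'
  have hX : I.volX x S = 0 := by
    refine le_antisymm ((I.volX_le h.x_nonneg hr S).trans_eq (by rw [hβ, mul_zero])) ?_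
    rw [volX_eq, hβ, zero_add]
    exact I.weight_nonneg h.x_nonneg _
  have hcost : ∀ e, I.cost e * x e = 0 := fun e => by
    have hlp : I.lpValue x = 0 := by rw [← I.mul_beta hr, hβ, mul_zero]
    exact (Finset.sum_eq_zero_iff_of_nonneg fun e _ =>
      mul_nonneg (I.cost_nonneg e) (h.x_nonneg e)).1 hlp e (Finset.mem_univ e)
  obtain ⟨ρ, hρ, hN⟩ := exists_count_le_one (continuous_clippedMass _ _ _ _).continuousOn
    (fun s _ => hasDerivWithinAt_clippedMass_one (I.edgesIn S \ F)
      (I.nearDist_le_farDist (lengths x y i) (I.source i)) s)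
    (h.clippedMass_one_sub_le S i (I.source i))
  have hcut : I.costOf ((F ∩ I.edgesIn S) ∩ I.crossing x y i (I.source i) ρ) = 0 := by
    refine Finset.sum_eq_zero fun e _ => Set.indicator_apply_eq_zero.2 fun he => ?_
    have hlen := h.farDist_sub_nearDist_le i (I.source i) e
    rw [h.lengths_eq_x he.1.1] at hlen
    exact (mul_eq_zero.1 (hcost e)).resolve_right (by linarith [he.2.1, he.2.2])
  have hle := (costButMax_cut_ballIn_le S i (I.source i) hρ.1 hρ.2 hN).trans_eq hcut
  exact ⟨ρ, hρ.1, hρ.2, by simpa [hX] using hle, by simpa [hX] using hle⟩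

variable {S} in
theorem IsRoundable.cutBound_le {W W' : ℝ} (hW : I.beta x ≤ W) (hWW' : W ≤ W')
    (hW' : W' ≤ I.volX x S) :
    cutBound (r + 1) (I.volX x S) W ≤ cutBound (r + 1) (I.volX x S) W' := by
  have hR : (1 : ℝ) ≤ r + 1 := le_add_of_nonneg_left r.cast_nonneg
  have hW0 := (I.beta_nonneg h.x_nonneg).trans hW
  exact monotoneOn_cutBound hR _ ⟨hW0, hWW'.trans hW'⟩ ⟨hW0.trans hWW', hW'⟩ hWW'

theorem IsRoundable.exists_goodRadius_of_beta_pos (hβ : 0 < I.beta x) :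
    ∃ ρ, I.GoodRadius F x y S i ρ := by
  have hnear := I.nearDist_nonneg (lengths x y i) (I.source i)
  have hnf := I.nearDist_le_farDist (lengths x y i) (I.source i)
  obtain ⟨ρ, hρ, hN, hin, hout⟩ := exists_radius
    (p := fun ρ => I.costOf ((F ∩ I.edgesIn S) ∩ I.crossing x y i (I.source i) ρ))
    (fun ρ _ => Finset.sum_nonneg fun e _ => Set.indicator_nonneg (fun e _ => I.cost_nonneg e) e)
    (continuous_clippedMass _ _ _ _).continuousOn
    (fun s _ => hasDerivWithinAt_clippedMass_one (I.edgesIn S \ F) hnf s)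
    (h.clippedMass_one_sub_le S i (I.source i)) (continuous_clippedMass _ _ _ _).continuousOn
    (fun s _ => hasDerivWithinAt_clippedMass (F ∩ I.edgesIn S) I.cost hnf s)
    (clippedMass_zero _ _ hnear hnf) hβ (add_le_add_right (h.clippedMass_cost_le S i _) _)
    (I.volX_le h.x_nonneg i.pos.ne' S)
  have hcut := costButMax_cut_ballIn_le S i (I.source i) hρ.1 hρ.2 hN
  have hmass := clippedMass_mem_Icc (D := F ∩ I.edgesIn S) I.cost_nonneg hnear hnf
    (Set.Ico_subset_Icc_self hρ)
  exact ⟨ρ, hρ.1, hρ.2,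
    hcut.trans (hin.trans (h.cutBound_le (le_add_of_nonneg_right hmass.1) (h.le_vol S i _ hρ.1 hρ.2)
      ((h.vol_le S i _ hρ.1 hρ.2).trans h.regionVol_le_volX))),
    hcut.trans (hout.trans (h.cutBound_le (le_add_of_nonneg_right (sub_nonneg.2 hmass.2))
      (h.le_volOut S i _ hρ.1 hρ.2) ((h.volOut_le S i _ hρ.1 hρ.2).trans h.regionVol_le_volX)))⟩

theorem IsRoundable.exists_goodRadius : ∃ ρ, I.GoodRadius F x y S i ρ :=
  (I.beta_nonneg h.x_nonneg).eq_or_lt.elim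
    (fun hβ => h.exists_goodRadius_of_beta_eq_zero S i hβ.symm)
    (h.exists_goodRadius_of_beta_pos S i)

end GoodRadius

section Steps

variable {V E : Type*} [Fintype E] {r : ℕ} {I : MulticutInstance V E r} {F : Set E} {x : E → ℝ}
  {y : Fin r → E → ℝ} {T : Set (Fin r)} {S A : Set V} {R : Set (Set V)} {Y Z : Set E}

section Pairs

omit [Fintype E]

theorem pairsIn_pairsIn : I.pairsIn (I.pairsIn T A) A = I.pairsIn T A :=
  Set.ext fun _ => ⟨fun h => h.1, fun h => ⟨h, h.2⟩⟩

theorem pairsIn_union_subset (h : A ⊆ S) :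
    I.pairsIn T A ∪ I.pairsIn T (S \ A) ⊆ I.pairsIn T S := by
  rintro i (hi | hi)
  exacts [⟨hi.1, h hi.2.1, h hi.2.2⟩, ⟨hi.1, hi.2.1.1, hi.2.2.1⟩]

theorem ncard_pairsIn_union :
    (I.pairsIn T A ∪ I.pairsIn T (S \ A)).ncard =
      (I.pairsIn T A).ncard + (I.pairsIn T (S \ A)).ncard :=
  Set.ncard_union_eq (Set.disjoint_left.2 fun _ hi hi' => hi'.2.1.2 hi.2.1)

theorem ncard_pairsIn_add_le (h : A ⊆ S) :
    (I.pairsIn T A).ncard + (I.pairsIn T (S \ A)).ncard ≤ T.ncard := by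
  rw [← ncard_pairsIn_union]
  exact Set.ncard_le_ncard ((pairsIn_union_subset h).trans fun _ hi => hi.1)

theorem ncard_pairsIn_add_lt {i : Fin r} (h : A ⊆ S) (hi : i ∈ I.pairsIn T S)
    (hsep : ¬(I.source i ∈ A ↔ I.sink i ∈ A)) :
    (I.pairsIn T A).ncard + (I.pairsIn T (S \ A)).ncard < (I.pairsIn T S).ncard := by
  rw [← ncard_pairsIn_union]
  refine Set.ncard_lt_ncard ⟨pairsIn_union_subset h, fun hsub => hsep ?_⟩
  rcases hsub hi with hA | hSA
  · exact iff_of_true hA.2.1 hA.2.2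
  · exact iff_of_false hSA.2.1.2 hSA.2.2.2

theorem two_mul_ncard_pairsIn_region_le (i : Fin r) (ρ : ℝ) :
    2 * (I.pairsIn T (I.region x y T S i ρ)).ncard ≤ T.ncard := by
  rw [region]
  split_ifs with hle
  · exact hle
  · have hadd : (I.pairsIn T (I.ballIn x y S i (I.source i) ρ)).ncard + _ ≤ T.ncard :=
      ncard_pairsIn_add_le Set.inter_subset_right
    rw [sdiff_ballIn] at hadd
    lia

end Pairs

theorem Step.two_mul_ncard_le (hs : I.Step F x y T S A Y) :
    2 * (I.pairsIn T A).ncard ≤ T.ncard := by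
  obtain ⟨i, -, ρ, -, rfl, -⟩ := hs
  exact two_mul_ncard_pairsIn_region_le i ρ

theorem Step.subset (hs : I.Step F x y T S A Y) : A ⊆ S := by
  obtain ⟨i, -, ρ, -, rfl, -⟩ := hs
  rw [region]
  split_ifs
  exacts [Set.inter_subset_right, Set.sdiff_subset]

theorem Step.isAllButMax (hs : I.Step F x y T S A Y) : I.IsAllButMax (I.cut S A) Y := by
  obtain ⟨i, -, ρ, -, -, hY⟩ := hs
  exact hY

theorem Step.exists_separated (h : I.IsRoundable F x y) (hs : I.Step F x y T S A Y) :
    ∃ i ∈ I.pairsIn T S, ¬(I.source i ∈ A ↔ I.sink i ∈ A) := by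
  obtain ⟨i, ⟨hiT, hconn⟩, ρ, ⟨h0, h1, -⟩, rfl, -⟩ := hs
  obtain ⟨hsource, hsink⟩ := hconn.ends_mem two_ne_zero (I.source_ne_sink i)
  have hin : I.source i ∈ I.ball (lengths x y i) (I.source i) ρ := by
    rwa [mem_ball_iff h0 h1, truncDist_self]
  have hout : I.sink i ∉ I.ball (lengths x y i) (I.source i) ρ := by
    rwa [mem_ball_iff h0 h1, truncDist_eq_one (h.walk i), not_le]
  refine ⟨i, ⟨hiT, hsource, hsink⟩, ?_⟩
  rw [region]
  split_ifs
  · simp [ballIn, hin, hout, hsource]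
  · simp [ballOut, hin, hout, hsink]

theorem Step.ncard_pairsIn_add_lt (h : I.IsRoundable F x y) (hs : I.Step F x y T S A Y) :
    (I.pairsIn T A).ncard + (I.pairsIn T (S \ A)).ncard < (I.pairsIn T S).ncard := by
  obtain ⟨i, hi, hsep⟩ := hs.exists_separated h
  exact MulticutInstance.ncard_pairsIn_add_lt hs.subset hi hsep

theorem Loop.two_mul_ncard_le (hl : I.Loop F x y T S R Z) :
    ∀ A ∈ R, 2 * (I.pairsIn T A).ncard ≤ T.ncard ∧ T.Nonempty := by
  induction hl with
  | done _ _ => simp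
  | step S A Y R _ hs _ ih =>
    obtain ⟨i, hi, -⟩ := id hs
    exact Set.forall_mem_insert.2 ⟨⟨hs.two_mul_ncard_le, i, hi.1⟩, ih⟩

section Halting

variable (h : I.IsRoundable F x y)
include h

theorem IsRoundable.loopHalts (T : Set (Fin r)) (S : Set V) : I.LoopHalts F x y T S := by
  induction hn : (I.pairsIn T S).ncard using Nat.strong_induction_on generalizing S with
  | _ n ih =>
    refine .intro S (fun i _ => h.exists_goodRadius S i) fun A Y hs => ih _ ?_ _ rfl
    have := hs.ncard_pairsIn_add_lt h
    lia

theorem IsRoundable.halts (U : Set V) (T : Set (Fin r)) : I.Halts F x y U T := by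
  induction hn : T.ncard using Nat.strong_induction_on generalizing U T with
  | _ n ih =>
    refine .intro U T (h.loopHalts T U) fun R Z hl A hA => ih _ ?_ _ _ rfl
    obtain ⟨hhalf, hT⟩ := hl.two_mul_ncard_le A hA
    have := (Set.ncard_pos T.toFinite).2 hT
    lia

end Halting

section Feasibility

omit [Fintype E] in
theorem IsAllButMax.sdiff_subsingleton {D : Set E} (h : I.IsAllButMax D Y) :
    (D \ Y).Subsingleton := by
  rcases h with ⟨rfl, rfl⟩ | ⟨e, he, -, rfl⟩
  · simp
  · rw [Set.sdiff_sdiff_cancel_left (Set.singleton_subset_iff.2 he)]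
    exact Set.subsingleton_singleton

theorem Loop.not_edgeConnected (hl : I.Loop F x y T S R Z) (sub : Set V → Set E)
    (hsub : ∀ A ∈ R, ∀ i ∈ I.pairsIn T A,
      ¬I.EdgeConnected (I.edgesIn A \ sub A) 2 (I.source i) (I.sink i)) :
    ∀ i ∈ T, ¬I.EdgeConnected (I.edgesIn S \ (Z ∪ ⋃ A ∈ R, sub A)) 2 (I.source i) (I.sink i) := by
  induction hl with
  | done S hact => exact fun i hi hc => hact.subset ⟨hi, hc.mono Set.sdiff_subset⟩
  | step S A Y R Z hs _ ih =>
    intro i hi hc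
    rw [Set.biUnion_insert] at hc
    rw [Set.forall_mem_insert] at hsub
    have hcut : ((I.edgesIn S \ (Y ∪ Z ∪ (sub A ∪ ⋃ A ∈ R, sub A))) ∩ I.cut S A).Subsingleton :=
      hs.isAllButMax.sdiff_subsingleton.anti fun e he =>
        ⟨he.2, fun hY => he.1.2 (Or.inl (Or.inl hY))⟩
    rcases hc.side_of_cut_subsingleton Set.sdiff_subset hcut hs.subset (I.source_ne_sink i) with
      ⟨hsource, hsink, hcA⟩ | hcSA
    · exact hsub.1 i ⟨hi, hsource, hsink⟩
        (hcA.mono fun e he => ⟨he.2, fun hA => he.1.2 (Or.inr (Or.inl hA))⟩)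
    · exact ih hsub.2 i hi (hcSA.mono fun e he => ⟨he.2, fun hZ => he.1.2 <|
        hZ.imp Or.inr Or.inr⟩)

theorem Output.not_edgeConnected {U : Set V} (ho : I.Output F x y U T Z) :
    ∀ i ∈ T, ¬I.EdgeConnected (I.edgesIn U \ Z) 2 (I.source i) (I.sink i) := by
  induction ho with
  | mk U T R Z sub hl _ ih => exact hl.not_edgeConnected sub ih

theorem Output.isFeasible (ho : I.Output F x y Set.univ Set.univ Z) : I.IsFeasible 2 Z :=
  fun i hc => ho.not_edgeConnected i (Set.mem_univ i)
    (hc.mono fun _ he => ⟨⟨Set.mem_univ _, Set.mem_univ _⟩, he⟩)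

end Feasibility

end Steps

end MulticutInstance

section Charging

open Real

/-- The edges inside the region, of weight `w'`, are charged for the levels of recursion below. -/
theorem charge_region {β w w' K K₀ R d : ℝ} (hβ : 0 ≤ β) (hw' : 0 ≤ w') (hww : w' ≤ w)
    (hwK : β + w ≤ K) (hK : K ≤ K₀) (hK₀ : K₀ ≤ R * β) (hd : 0 ≤ d) :
    (β + w) * log (exp 1 * K / (β + w)) + w' * (d + log ((β + w') / β)) ≤
      w * (d + 1 + log (K₀ / β)) + β * log (exp 1 * R) := by
  have hw := hw'.trans hww
  rcases hβ.eq_or_lt with rfl | hβ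
  · obtain rfl : w = 0 := by linarith
    obtain rfl : w' = 0 := by linarith
    simp
  · have hK0 : 0 < K := by linarith
    have hβw : 0 < β + w := by linarith
    have hR : 0 < R := pos_of_mul_pos_left (hK0.trans_le (hK.trans hK₀)) hβ.le
    have htelescope : log (exp 1 * K / (β + w)) ≤ 1 + log (K₀ / β) - log ((β + w) / β) := by
      rw [log_div (by positivity) hβw.ne', log_mul (exp_ne_zero _) hK0.ne', log_exp,
        log_div hβw.ne' hβ.ne', log_div (hK0.trans_le hK).ne' hβ.ne']
      linarith [log_le_log hK0 hK]
    have hR₀ : 1 + log (K₀ / β) ≤ log (exp 1 * R) := by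
      rw [log_mul (exp_ne_zero _) hR.ne', log_exp]
      exact add_le_add_right
        (log_le_log (div_pos (hK0.trans_le hK) hβ) ((div_le_iff₀ hβ).2 hK₀)) 1
    have hlog : 0 ≤ log ((β + w) / β) :=
      log_nonneg ((one_le_div hβ).2 (le_add_of_nonneg_right hw))
    have hinside : w' * (d + log ((β + w') / β)) ≤ w * (d + log ((β + w) / β)) := by
      gcongr
      exact add_nonneg hd (log_nonneg ((one_le_div hβ).2 (le_add_of_nonneg_right hw')))
    have hcut := mul_le_mul_of_nonneg_left htelescope hβw.le
    have hpair := mul_le_mul_of_nonneg_left hR₀ hβ.le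
    have hdrop := mul_nonneg hβ.le hlog
    linarith

theorem one_le_log_exp_mul_succ (r : ℕ) : 1 ≤ log (exp 1 * (r + 1)) :=
  one_le_log_exp_mul (le_add_of_nonneg_left r.cast_nonneg)

theorem log_log_exp_mul_succ_nonneg (r : ℕ) : 0 ≤ log (log (exp 1 * (r + 1))) :=
  log_nonneg (one_le_log_exp_mul_succ r)

theorem natLog_two_le {n : ℕ} (hn : n ≠ 0) : (Nat.log 2 n : ℝ) ≤ 2 * log (n + 1) := by
  have hpow : (2 : ℝ) ^ Nat.log 2 n ≤ n + 1 :=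
    mod_cast (Nat.pow_log_le_self 2 hn).trans n.le_succ
  have hlog := log_le_log (by positivity) hpow
  rw [log_pow] at hlog
  nlinarith [log_two_gt_d9, Nat.cast_nonneg (α := ℝ) (Nat.log 2 n)]

end Charging

namespace MulticutInstance

open Multigraph Real

section Cost

variable {V E : Type*} [Fintype E] {r : ℕ} {I : MulticutInstance V E r} {F : Set E} {x : E → ℝ}
  {y : Fin r → E → ℝ} {T : Set (Fin r)} {S A : Set V} {R : Set (Set V)} {Y Z : Set E}
  {d K K₀ : ℝ}

/-- The amount that is charged for the set `S` and the pairs of `T`: every edge in `E(S)` pays in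
proportion to its weight, for `d` levels of recursion and for the logarithm that telescopes from the
volume `K` down to `β`, and every pair contained in `S` pays a multiple of `β`. -/
noncomputable def costBound (I : MulticutInstance V E r) (x : E → ℝ) (d K : ℝ) (T : Set (Fin r))
    (S : Set V) : ℝ :=
  4 * log (log (exp 1 * (r + 1))) * (I.weight x (I.edgesIn S) * (d + log (K / I.beta x)) +
    (I.pairsIn T S).ncard * (I.beta x * log (exp 1 * (r + 1))))

theorem costBound_nonneg (hx : ∀ e, 0 ≤ x e) (hd : 0 ≤ d) (hK : I.volX x S ≤ K) :
    0 ≤ I.costBound x d K T S := by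
  have hL := log_log_exp_mul_succ_nonneg r
  have hΛ := one_le_log_exp_mul_succ r
  have hw := I.weight_nonneg hx (I.edgesIn S)
  have hβ := I.beta_nonneg hx
  have hlog : 0 ≤ log (K / I.beta x) := by
    rcases hβ.eq_or_lt with h0 | h0
    · rw [← h0, div_zero, log_zero]
    · rw [volX_eq] at hK
      exact log_nonneg ((one_le_div h0).2 (by linarith))
  unfold costBound
  positivity

section Rounding

variable (h : I.IsRoundable F x y)
include h

theorem Step.costButMax_cut_le (hs : I.Step F x y T S A Y) :
    I.costButMax (I.cut S A) ≤ cutBound (r + 1) (I.volX x S) (I.regionVol x S A) := by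
  obtain ⟨i, -, ρ, ⟨h0, h1, hin, hout⟩, rfl, -⟩ := hs
  rw [region]
  split_ifs
  · exact hin.trans (h.cutBound_le (h.beta_le_vol S i _ h0 h1) (h.vol_le S i _ h0 h1)
      h.regionVol_le_volX)
  · have hcut : I.cut S (I.ballOut x y S i (I.source i) ρ) =
        I.cut S (I.ballIn x y S i (I.source i) ρ) := by
      rw [← sdiff_ballIn]
      exact I.cut_sdiff Set.inter_subset_right
    rw [hcut]
    exact hout.trans (h.cutBound_le (h.beta_le_volOut S i _ h0 h1) (h.volOut_le S i _ h0 h1)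
      h.regionVol_le_volX)

theorem Step.costOf_add_le (hs : I.Step F x y T S A Y) (hd : 0 ≤ d) (hS : I.volX x S ≤ K₀)
    (hK₀ : K₀ ≤ (r + 1) * I.beta x) :
    I.costOf Y + (I.costBound x d (I.volX x A) T A + I.costBound x (d + 1) K₀ T (S \ A)) ≤
      I.costBound x (d + 1) K₀ T S := by
  have hY := hs.isAllButMax.costOf_le.trans (hs.costButMax_cut_le h)
  rw [cutBound_eq] at hY
  have hΛ := mul_nonneg (I.beta_nonneg h.x_nonneg)
    (zero_le_one.trans (one_le_log_exp_mul_succ r))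
  have hsplit := I.weight_sdiff_add x (I.edgesIn_mono (Set.sdiff_subset : S \ A ⊆ S))
  have hinside : I.weight x (I.edgesIn A) ≤ I.weight x (I.edgesIn S \ I.edgesIn (S \ A)) :=
    I.weight_mono h.x_nonneg fun e he =>
      ⟨I.edgesIn_mono hs.subset he, fun he' => he'.1.2 he.1⟩
  have hcharge := charge_region (I.beta_nonneg h.x_nonneg) (I.weight_nonneg h.x_nonneg _) hinside
    h.regionVol_le_volX hS hK₀ hd
  have hpairs : ((I.pairsIn T A).ncard : ℝ) + (I.pairsIn T (S \ A)).ncard + 1 ≤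
      (I.pairsIn T S).ncard := mod_cast hs.ncard_pairsIn_add_lt h
  have hpairs' := mul_le_mul_of_nonneg_right hpairs hΛ
  refine (add_le_add_left hY _).trans ?_
  simp only [costBound, regionVol, volX_eq, ← hsplit] at hcharge ⊢
  rw [← mul_add, ← mul_add]
  refine mul_le_mul_of_nonneg_left ?_ (mul_nonneg (by norm_num) (log_log_exp_mul_succ_nonneg r))
  linarith

theorem Loop.costOf_le (hl : I.Loop F x y T S R Z) (sub : Set V → Set E) (hd : 0 ≤ d)
    (hS : I.volX x S ≤ K₀) (hK₀ : K₀ ≤ (r + 1) * I.beta x)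
    (hsub : ∀ A ∈ R, I.costOf (sub A) ≤ I.costBound x d (I.volX x A) T A) :
    I.costOf (Z ∪ ⋃ A ∈ R, sub A) ≤ I.costBound x (d + 1) K₀ T S := by
  induction hl with
  | done S _ =>
    rw [Set.biUnion_empty, Set.union_empty, costOf_empty]
    exact costBound_nonneg h.x_nonneg (by positivity) hS
  | step S A Y R Z hs _ ih =>
    rw [Set.forall_mem_insert] at hsub
    have hrest := ih ((I.volX_mono h.x_nonneg Set.sdiff_subset).trans hS) hsub.2
    rw [Set.biUnion_insert, Set.union_assoc, Set.union_left_comm Z]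
    calc _ ≤ I.costOf Y + (I.costOf (sub A) + I.costOf (Z ∪ ⋃ A ∈ R, sub A)) :=
          (I.costOf_union_le _ _).trans (add_le_add_right (I.costOf_union_le _ _) _)
      _ ≤ I.costOf Y + (I.costBound x d (I.volX x A) T A + I.costBound x (d + 1) K₀ T (S \ A)) := by
          gcongr
          exact hsub.1
      _ ≤ I.costBound x (d + 1) K₀ T S := hs.costOf_add_le h hd hS hK₀

end Rounding

theorem Output.eq_empty (ho : I.Output F x y S T Z) (hT : T = ∅) : Z = ∅ := by
  rcases ho with ⟨_, _, R, Z, sub, hl, -⟩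
  cases hl with
  | done S h => simp
  | step S A Y R Z hs hl =>
    obtain ⟨i, hi, -⟩ := hs
    exact absurd (hT ▸ hi.1) (Set.notMem_empty i)

theorem Output.costOf_le (h : I.IsRoundable F x y) (hr : r ≠ 0) (ho : I.Output F x y S T Z)
    {d : ℕ} (hd : T.ncard < 2 ^ d) : I.costOf Z ≤ I.costBound x d (I.volX x S) T S := by
  induction ho generalizing d with
  | mk S T R Z sub hl hrec ih =>
    cases d with
    | zero =>
      have hT : T = ∅ := (Set.ncard_eq_zero T.toFinite).1 (by simpa using hd)
      rw [(Output.mk S T R Z sub hl hrec).eq_empty hT, costOf_empty]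
      exact costBound_nonneg h.x_nonneg (Nat.cast_nonneg _) le_rfl
    | succ d =>
      rw [Nat.cast_succ]
      refine hl.costOf_le h sub (Nat.cast_nonneg d) le_rfl (I.volX_le h.x_nonneg hr S)
        fun A hA => ?_
      have hhalf := (hl.two_mul_ncard_le A hA).1
      have hA := ih A hA (d := d) (by lia)
      rwa [costBound, pairsIn_pairsIn] at hA

theorem log_volX_div_beta_le (hx : ∀ e, 0 ≤ x e) (hr : r ≠ 0) (S : Set V) :
    log (I.volX x S / I.beta x) ≤ log (r + 1) := by
  rcases (I.beta_nonneg hx).eq_or_lt with h0 | h0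
  · rw [← h0, div_zero, log_zero]
    exact log_nonneg (le_add_of_nonneg_left r.cast_nonneg)
  · have hvol : 0 < I.volX x S := add_pos_of_pos_of_nonneg h0 (I.weight_nonneg hx _)
    exact log_le_log (div_pos hvol h0) ((div_le_iff₀ h0).2 (I.volX_le hx hr S))

theorem costBound_univ_le (hx : ∀ e, 0 ≤ x e) (hr : r ≠ 0) :
    I.costBound x ((Nat.log 2 r + 1 : ℕ) : ℝ) (I.volX x Set.univ) Set.univ Set.univ ≤
      32 * (log (r + 1) * log (log (exp 1 * (r + 1)))) * I.lpValue x := by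
  have hlp := I.lpValue_nonneg hx
  have hL := log_log_exp_mul_succ_nonneg r
  have hdepth := natLog_two_le hr
  have hvol := log_volX_div_beta_le (I := I) hx hr Set.univ
  have hone : 1 ≤ 2 * log ((r : ℝ) + 1) := by
    have : (2 : ℝ) ≤ r + 1 := mod_cast Nat.succ_le_succ (Nat.one_le_iff_ne_zero.2 hr)
    linarith [log_le_log two_pos this, log_two_gt_d9]
  have hedges : I.weight x (I.edgesIn Set.univ) *
      ((Nat.log 2 r : ℝ) + 1 + log (I.volX x Set.univ / I.beta x)) ≤
      I.lpValue x * (5 * log (r + 1)) :=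
    (mul_le_mul_of_nonneg_left (by linarith) (I.weight_nonneg hx _)).trans
      (mul_le_mul_of_nonneg_right (I.weight_le_lpValue hx _) (by linarith))
  have hpairs : I.lpValue x * log (exp 1 * (r + 1)) ≤ I.lpValue x * (3 * log (r + 1)) := by
    rw [log_mul (exp_ne_zero _) (by positivity), log_exp]
    exact mul_le_mul_of_nonneg_left (by linarith) hlp
  have hcard : (I.pairsIn Set.univ Set.univ).ncard = r := by simp [pairsIn, Set.ncard_univ]
  rw [costBound, hcard, ← mul_assoc (r : ℝ), I.mul_beta hr, Nat.cast_succ]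
  calc _ ≤ 4 * log (log (exp 1 * (r + 1))) *
        (I.lpValue x * (5 * log (r + 1)) + I.lpValue x * (3 * log (r + 1))) := by gcongr
    _ = 32 * (log (r + 1) * log (log (exp 1 * (r + 1)))) * I.lpValue x := by ring

theorem Output.costOf_le_log (h : I.IsRoundable F x y) (ho : I.Output F x y Set.univ Set.univ Z) :
    I.costOf Z ≤ 32 * (log (r + 1) * log (log (exp 1 * (r + 1)))) * I.lpValue x := by
  rcases eq_or_ne r 0 with rfl | hr
  · rw [ho.eq_empty (Set.eq_empty_of_isEmpty _), costOf_empty]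
    simp
  · refine (ho.costOf_le h hr ?_).trans (costBound_univ_le h.x_nonneg hr)
    rw [Set.ncard_univ, Nat.card_fin]
    exact Nat.lt_pow_succ_log_self one_lt_two r

end Cost

end MulticutInstance

section Asymptotics

open Real

theorem log_mul_log_log_shift_le {r : ℝ} (hr : 3 ≤ r) :
    log (r + 1) * log (log (exp 1 * (r + 1))) ≤ 48 * (log r * log (log r)) := by
  have hlog : 1.05 ≤ log r := by linarith [log_three_gt_d9, log_le_log three_pos hr]
  have hshift : log (r + 1) ≤ 2 * log r := by
    rw [← Nat.cast_two, ← log_pow]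
    exact log_le_log (by linarith) (by nlinarith)
  have hlog_log : log (log (exp 1 * (r + 1))) ≤ 24 * log (log r) := by
    have hpow : 3 ≤ log r ^ 23 :=
      le_trans (by norm_num) (pow_le_pow_left₀ (by norm_num) hlog 23)
    rw [← Nat.cast_ofNat, ← log_pow]
    refine log_le_log (zero_lt_one.trans_le (one_le_log_exp_mul (by linarith))) ?_
    rw [log_mul (exp_ne_zero _) (by linarith), log_exp, pow_succ]
    nlinarith
  calc _ ≤ 2 * log r * (24 * log (log r)) := mul_le_mul hshift hlog_log
        (log_nonneg (one_le_log_exp_mul (by linarith))) (by linarith)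
    _ = 48 * (log r * log (log r)) := by ring

end Asymptotics

theorem theorem3p5_general :
    ∃ C : ℝ, 0 < C ∧
      ∀ {V : Type*} {E : Type*} [Fintype E] {r : ℕ} (I : MulticutInstance V E r)
        (x : E → ℝ) (y : Fin r → E → ℝ), I.IsLPFeasible 2 x y →
        I.TwoMCAlgHalts x y ∧
        ∀ Z : Set (E × Fin (r + 1)), I.TwoMCAlgOutput x y Z →
          I.subdivide.IsFeasible 2 Z ∧
          I.IsFeasible 2 (MulticutInstance.unsubdivide Z) ∧
          I.costOf (MulticutInstance.unsubdivide Z) ≤ I.subdivide.costOf Z ∧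
          I.subdivide.costOf Z ≤
            C * (Real.log (r + 1) * Real.log (Real.log (Real.exp 1 * (r + 1)))) * I.lpValue x ∧
          (3 ≤ r →
            I.subdivide.costOf Z ≤ C * (Real.log r * Real.log (Real.log r)) * I.lpValue x) := by
  refine ⟨1536, by norm_num, @fun V E _ r I x y hxy => ?_⟩
  have h := hxy.isRoundable
  refine ⟨h.halts _ _, fun Z hZ => ?_⟩
  have hcost := hZ.costOf_le_log h
  rw [I.lpValue_subdivide] at hcost
  have hlp := I.lpValue_nonneg hxy.x_nonneg
  refine ⟨hZ.isFeasible, hZ.isFeasible.unsubdivide,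
    I.costOf_unsubdivide_le Z, hcost.trans ?_, fun hr => hcost.trans ?_⟩
  · have hL := log_log_exp_mul_succ_nonneg
    gcongr
    · exact mul_nonneg (Real.log_nonneg (by simp)) (hL _)
    · norm_num
  · refine mul_le_mul_of_nonneg_right ?_ hlp
    linarith [log_mul_log_log_shift_le (r := r) (mod_cast hr)]

theorem theorem3p5 :
    ∃ C : ℝ, 0 < C ∧
      ∀ {V : Type*} {E : Type*} [Fintype V] [Fintype E] {r : ℕ} (I : MulticutInstance V E r)
        (x : E → ℝ) (y : Fin r → E → ℝ), I.IsLPOptimal 2 x y →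
        I.TwoMCAlgHalts x y ∧
        ∀ Z : Set (E × Fin (r + 1)), I.TwoMCAlgOutput x y Z →
          I.subdivide.IsFeasible 2 Z ∧
          I.IsFeasible 2 (MulticutInstance.unsubdivide Z) ∧
          I.costOf (MulticutInstance.unsubdivide Z) ≤ I.subdivide.costOf Z ∧
          I.subdivide.costOf Z ≤
            C * (Real.log (r + 1) * Real.log (Real.log (Real.exp 1 * (r + 1)))) * I.lpValue x ∧
          (3 ≤ r →
            I.subdivide.costOf Z ≤ C * (Real.log r * Real.log (Real.log r)) * I.lpValue x) := by
  obtain ⟨C, hC, h⟩ := theorem3p5_general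
  exact ⟨C, hC, fun I x y hopt => h I x y hopt.1⟩
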